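/- Let $(M,g)$ be a (finite-dimensional, smooth) Riemannian manifold, let $(N,J,h)$ be a Kähler manifold, and let $\phi : M \to N$ be a smooth map. For $x\in M$ let $(d\phi_x)^{*} : T_{\phi(x)}N \to T_xM$ denote the adjoint of $d\phi_x$ with respect to $g$ and $h$. The map $\phi$ is called a pseudo harmonic morphism if it is a harmonic map (its tension field $\tau(\phi)=\operatorname{tr}_g\nabla d\phi$ vanishes) and it is pseudo horizontally weakly conformal, i.e. $[d\phi\circ(d\phi)^{*},J]=0$. Then the following are equivalent: 1. for every open set $U\subseteq N$ and every function $f:U\to\mathbb{C}$ that is holomorphic or antiholomorphic, the function $f\circ\phi:\phi^{-1}(U)\to\mathbb{C}$ is harmonic on $(\phi^{-1}(U),g)$; 2. $\phi$ is a pseudo harmonic morphism. Moreover, if these conditions hold, then for every open $U\subseteq N$ and every holomorphic or antiholomorphic $f:U\to\mathbb{C}$, the map $f\circ\phi:(\phi^{-1}(U),g)\to\mathbb{C}$ is a harmonic morphism into $\mathbb{C}$ with its standard flat metric: for every open $W\subseteq\mathbb{C}$ and every harmonic function $k:W\to\mathbb{R}$, the function $k\circ f\circ\phi$ is harmonic on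 $(f\circ\phi)^{-1}(W)$. -/

import Mathlib

open Set Bundle
open scoped Manifold ContDiff ComplexConjugate

noncomputable section

namespace PHM

/-- A complex manifold is in particular a real manifold (of twice the dimension). -/
instance isManifold_real_of_complex {F : Type*} [NormedAddCommGroup F] [NormedSpace ℂ F]
    {N : Type*} [TopologicalSpace N] [ChartedSpace F N] {n : ℕ∞ω} [IsManifold 𝓘(ℂ, F) n N] :
    IsManifold 𝓘(ℝ, F) n N := by
  refine isManifold_of_contDiffOn _ _ _ fun e e' he he' => ?_
  have h := (contDiffGroupoid n 𝓘(ℂ, F)).compatible he he'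
  rw [contDiffGroupoid, mem_groupoid_of_pregroupoid] at h
  have h1 := h.1
  simp only [contDiffPregroupoid] at h1
  simpa using h1.restrict_scalars ℝ

section Riemannian

variable {E : Type*} [NormedAddCommGroup E] [NormedSpace ℝ E]
  {V : Type*} [NormedAddCommGroup V] [NormedSpace ℝ V]

/-- Smooth Riemannian metrics on the (real) tangent bundle of a manifold `M` modelled on `E`. -/
abbrev SmoothMetric (E : Type*) [NormedAddCommGroup E] [NormedSpace ℝ E]
    (M : Type*) [TopologicalSpace M] [ChartedSpace E M] [IsManifold 𝓘(ℝ, E) ∞ M] :=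
  ContMDiffRiemannianMetric 𝓘(ℝ, E) ∞ E (fun x : M => TangentSpace 𝓘(ℝ, E) x)

/-- The standard flat metric of `ℂ = ℝ²`. -/
def flatMetric : SmoothMetric ℂ ℂ where
  inner := (riemannianMetricVectorSpace ℂ).inner
  symm := (riemannianMetricVectorSpace ℂ).symm
  pos := (riemannianMetricVectorSpace ℂ).pos
  isVonNBounded := (riemannianMetricVectorSpace ℂ).isVonNBounded
  contMDiff := (riemannianMetricVectorSpace ℂ).contMDiff.of_le le_top

/-- The Christoffel symbols at `y` of a metric `G` on an open subset of `E`: `christoffel G y u v`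
is the vector `Γ` with
`G(Γ, w) = ½ (∂_u G(v, w) + ∂_v G(u, w) - ∂_w G(u, v))` for all `w`. -/
def christoffel (G : E → E →L[ℝ] E →L[ℝ] ℝ) (y u v : E) : E :=
  (G y).inverse ((1 / 2 : ℝ) •
    (fderiv ℝ G y u v + fderiv ℝ G y v u - ((fderiv ℝ G y).flip u).flip v))

/-- The trace `∑ Gⁱʲ T(eᵢ, eⱼ)` of a bilinear `T` with respect to an inner product `G`. Here
`G.inverse (eʲ) = ∑ᵢ Gⁱʲ eᵢ` is the vector dual to the `j`-th coordinate of the basis. -/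
def metricTrace [FiniteDimensional ℝ E] (G : E →L[ℝ] E →L[ℝ] ℝ) (T : E → E → V) : V :=
  ∑ j, T (Module.finBasis ℝ E j)
    (G.inverse (LinearMap.toContinuousLinearMap ((Module.finBasis ℝ E).coord j)))

variable {M : Type*} [TopologicalSpace M] [ChartedSpace E M] [IsManifold 𝓘(ℝ, E) ∞ M]

/-- The metric `g` in the preferred chart at `x₀`: its pullback by the inverse of the chart. -/
def chartMetric (g : SmoothMetric E M) (x₀ : M) (y : E) : E →L[ℝ] E →L[ℝ] ℝ :=
  let A : E →L[ℝ] E := mfderiv 𝓘(ℝ, E) 𝓘(ℝ, E) (extChartAt 𝓘(ℝ, E) x₀).symm y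
  let B : E →L[ℝ] E →L[ℝ] ℝ := g.inner ((extChartAt 𝓘(ℝ, E) x₀).symm y)
  B.bilinearComp A A

/-- The Laplace-Beltrami operator `Δf = ∑ gⁱʲ (∂ᵢ∂ⱼ f - Γᵢⱼᵏ ∂ₖ f)` on (vector-valued) functions,
computed at `x` in the preferred chart at `x`. -/
def laplaceBeltrami [FiniteDimensional ℝ E] (g : SmoothMetric E M) (f : M → V) (x : M) : V :=
  let y : E := extChartAt 𝓘(ℝ, E) x x
  let f' : E → V := f ∘ (extChartAt 𝓘(ℝ, E) x).symm
  metricTrace (chartMetric g x y) fun u v =>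
    fderiv ℝ (fderiv ℝ f') y u v - fderiv ℝ f' y (christoffel (chartMetric g x) y u v)

/-- `f` is a harmonic function on the (open) set `U`. -/
def HarmonicOn [FiniteDimensional ℝ E] (g : SmoothMetric E M) (f : M → V) (U : Set M) : Prop :=
  ContMDiffOn 𝓘(ℝ, E) 𝓘(ℝ, V) 2 f U ∧ ∀ x ∈ U, laplaceBeltrami g f x = 0

variable {F : Type*} [NormedAddCommGroup F] [NormedSpace ℝ F]
  {N : Type*} [TopologicalSpace N] [ChartedSpace F N] [IsManifold 𝓘(ℝ, F) ∞ N]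

/-- The tension field `τ(φ) = tr_g ∇dφ` of a map `φ : (M, g) → (N, h)`, i.e.
`τ(φ)^γ = ∑ gⁱʲ (∂ᵢ∂ⱼ φ^γ - Γᵢⱼᵏ ∂ₖ φ^γ + Γ^γ_{αβ} ∂ᵢφ^α ∂ⱼφ^β)`,
computed at `x` in the preferred charts at `x` and `φ x`. -/
def tension [FiniteDimensional ℝ E] (g : SmoothMetric E M) (h : SmoothMetric F N)
    (φ : M → N) (x : M) : TangentSpace 𝓘(ℝ, F) (φ x) :=
  let y : E := extChartAt 𝓘(ℝ, E) x x
  let z : F := extChartAt 𝓘(ℝ, F) (φ x) (φ x)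
  let φ' : E → F := writtenInExtChartAt 𝓘(ℝ, E) 𝓘(ℝ, F) x φ
  let τ : F := metricTrace (chartMetric g x y) fun u v =>
    fderiv ℝ (fderiv ℝ φ') y u v - fderiv ℝ φ' y (christoffel (chartMetric g x) y u v)
      + christoffel (chartMetric h (φ x)) z (fderiv ℝ φ' y u) (fderiv ℝ φ' y v)
  τ

/-- `φ : (M, g) → (N, h)` is a harmonic map. -/
def IsHarmonicMap [FiniteDimensional ℝ E] (g : SmoothMetric E M) (h : SmoothMetric F N)
    (φ : M → N) : Prop :=
  ContMDiff 𝓘(ℝ, E) 𝓘(ℝ, F) ∞ φ ∧ ∀ x, tension g h φ x = 0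

/-- The (local) map `ψ : (M, g) → (N, h)`, defined on the open set `U`, is a harmonic morphism:
it pulls back harmonic functions on open subsets of `N` to harmonic functions. -/
def IsHarmonicMorphismOn [FiniteDimensional ℝ E] [FiniteDimensional ℝ F]
    (g : SmoothMetric E M) (h : SmoothMetric F N) (ψ : M → N) (U : Set M) : Prop :=
  ContMDiffOn 𝓘(ℝ, E) 𝓘(ℝ, F) ∞ ψ U ∧
    ∀ (W : Set N) (k : N → ℝ), IsOpen W → HarmonicOn h k W →
      HarmonicOn g (k ∘ ψ) (U ∩ ψ ⁻¹' W)

/-- The adjoint `(dφ_x)^* : T_{φ(x)}N → T_xM` of the differential: the transpose of `dφ_x`, with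
the tangent spaces identified with their duals through `h` and `g`, so that
`g((dφ_x)^* w, v) = h(w, dφ_x v)`. -/
def adjointDifferential (g : SmoothMetric E M) (h : SmoothMetric F N) (φ : M → N) (x : M)
    (w : TangentSpace 𝓘(ℝ, F) (φ x)) : TangentSpace 𝓘(ℝ, E) x :=
  (g.inner x).inverse ((h.inner (φ x) w).comp (mfderiv 𝓘(ℝ, E) 𝓘(ℝ, F) φ x))

end Riemannian

section Complex

variable {F : Type*} [NormedAddCommGroup F] [NormedSpace ℂ F]
  {N : Type*} [TopologicalSpace N] [ChartedSpace F N]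

/-- The complex structure of the tangent spaces of a complex manifold: multiplication by `i` in
holomorphic coordinates. -/
def complexStructure (p : N) (v : TangentSpace 𝓘(ℝ, F) p) : TangentSpace 𝓘(ℝ, F) p :=
  let v' : F := v
  let w : F := Complex.I • v'
  w

variable [IsManifold 𝓘(ℂ, F) ω N]

/-- `h` is a Hermitian metric: `h(Ju, Jv) = h(u, v)`. -/
def IsHermitianMetric (h : SmoothMetric F N) : Prop :=
  ∀ (p : N) (u v : TangentSpace 𝓘(ℝ, F) p),
    h.inner p (complexStructure p u) (complexStructure p v) = h.inner p u v

/-- The fundamental form `ω(u, v) = h(Ju, v)` in the preferred (holomorphic) chart at `p`. -/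
def chartFundamentalForm (h : SmoothMetric F N) (p : N) (y u v : F) : ℝ :=
  chartMetric h p y (Complex.I • u) v

/-- `h` is a Kähler metric: it is Hermitian and its fundamental form `ω` is closed,
`dω(u, v, w) = ∂_u ω(v, w) + ∂_v ω(w, u) + ∂_w ω(u, v) = 0`. -/
def IsKahlerMetric (h : SmoothMetric F N) : Prop :=
  IsHermitianMetric h ∧
    ∀ (p : N) (u v w : F),
      let y : F := extChartAt 𝓘(ℝ, F) p p
      fderiv ℝ (fun y' => chartFundamentalForm h p y' v w) y u
        + fderiv ℝ (fun y' => chartFundamentalForm h p y' w u) y v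
        + fderiv ℝ (fun y' => chartFundamentalForm h p y' u v) y w = 0

/-- `f` is a holomorphic or an antiholomorphic function on the (open) set `U`. -/
def IsPMHolomorphicOn (f : N → ℂ) (U : Set N) : Prop :=
  MDifferentiableOn 𝓘(ℂ, F) 𝓘(ℂ, ℂ) f U ∨
    MDifferentiableOn 𝓘(ℂ, F) 𝓘(ℂ, ℂ) (fun p => conj (f p)) U

variable {E : Type*} [NormedAddCommGroup E] [NormedSpace ℝ E]
  {M : Type*} [TopologicalSpace M] [ChartedSpace E M] [IsManifold 𝓘(ℝ, E) ∞ M]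

/-- Pseudo horizontal weak conformality, `[dφ ∘ (dφ)^*, J] = 0`. -/
def IsPHWC (g : SmoothMetric E M) (h : SmoothMetric F N) (φ : M → N) : Prop :=
  ∀ (x : M) (w : TangentSpace 𝓘(ℝ, F) (φ x)),
    mfderiv 𝓘(ℝ, E) 𝓘(ℝ, F) φ x (adjointDifferential g h φ x (complexStructure (φ x) w)) =
      complexStructure (φ x) (mfderiv 𝓘(ℝ, E) 𝓘(ℝ, F) φ x (adjointDifferential g h φ x w))

/-- A pseudo harmonic morphism: a harmonic map that is pseudo horizontally weakly conformal. -/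
def IsPseudoHarmonicMorphism [FiniteDimensional ℝ E] (g : SmoothMetric E M)
    (h : SmoothMetric F N) (φ : M → N) : Prop :=
  IsHarmonicMap g h φ ∧ IsPHWC g h φ

end Complex

end PHM

end

/-! Everything is computed at one point, in a chart of `M` and a holomorphic chart of `N`. Write `D`
for the differential of `φ`, `Δφ` for the coordinatewise Laplacian of its local representative and
`Γ` for the Christoffel symbols of `h`. Then `Δ(f ∘ φ) = df(Δφ) + tr_g ∂²f(D, D)` and `τ(φ) = Δφ +
tr_g Γ(D, D)`.

Commutation of `D D*` with `J` says exactly that the `(2, 0)`-part of the pushed-forward inverse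
metric vanishes (`IsIsotropic`), so that `tr_g B(D, D) = 0` for every complex bilinear `B`
(`IsIsotropic.metricTrace_eq_zero`). Two such `B` matter: `∂²f` for holomorphic `f`, and `Γ`, which
is complex bilinear because `h` is Kähler (`christoffel_I_smul`). Hence for a pseudo harmonic
morphism `Δφ = τ(φ) = 0` and `Δ(f ∘ φ) = 0`.

Conversely, complex linear functions `l` of the chart as test functions give `Δφ = 0`. The squares
`l²` then give `tr_g l(D) l(D) = 0`, which polarizes to isotropy, and isotropy turns `Δφ = 0` into
`τ(φ) = 0`.

For the last claim, isotropy also gives `⟨dψ, dψ⟩ = 0` for `ψ = f ∘ φ`. The Hessian of a harmonic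
function on the plane has the form `Re(c z w)`, so its trace along `dψ` is `Re(c ⟨dψ, dψ⟩) = 0`. The
antiholomorphic case follows by conjugation. -/

noncomputable section

namespace PHM

open Filter Metric
open scoped Topology

/-! ### Smoothness of holomorphic functions of several variables -/

section SeveralComplexVariables

variable {F : Type*} [NormedAddCommGroup F] [NormedSpace ℂ F]

/-- The Cauchy estimate for the Fréchet derivative. -/
theorem norm_fderiv_le_of_bounded {f : F → ℂ} {x : F} {r C : ℝ} (hr : 0 < r)
    (hf : ∀ y ∈ closedBall x r, DifferentiableAt ℂ f y) (hC : ∀ y ∈ closedBall x r, ‖f y‖ ≤ C) :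
    ‖fderiv ℂ f x‖ ≤ C / r := by
  have hC0 : 0 ≤ C := (norm_nonneg _).trans (hC x (mem_closedBall_self hr.le))
  refine ContinuousLinearMap.opNorm_le_bound _ (by positivity) fun w => ?_
  rcases eq_or_ne w 0 with rfl | hw
  · simp
  have hw' : 0 < ‖w‖ := norm_pos_iff.2 hw
  have hmem : ∀ ζ ∈ closedBall (0 : ℂ) (r / ‖w‖), x + ζ • w ∈ closedBall x r := fun ζ hζ => by
    rw [mem_closedBall_zero_iff, le_div_iff₀ hw'] at hζ
    simpa [mem_closedBall_iff_norm, norm_smul] using hζ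
  have hd : ∀ ζ ∈ closedBall (0 : ℂ) (r / ‖w‖),
      HasDerivAt (fun ζ : ℂ => f (x + ζ • w)) (fderiv ℂ f (x + ζ • w) w) ζ := fun ζ hζ => by
    have h1 : HasDerivAt (fun ζ : ℂ => x + ζ • w) w ζ := by
      simpa using ((hasDerivAt_id ζ).smul_const w).const_add x
    exact (hf _ (hmem ζ hζ)).hasFDerivAt.comp_hasDerivAt ζ h1
  -- One-variable Cauchy estimate on the complex line through `x` in direction `w`; the disc of
  -- radius `r / ‖w‖` is carried into the ball of radius `r`.
  have h2 := Complex.norm_deriv_le_of_forall_mem_sphere_norm_le (c := 0) (R := r / ‖w‖) (C := C)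
    (f := fun ζ : ℂ => f (x + ζ • w)) (by positivity)
    (DifferentiableOn.diffContOnCl (s := ball 0 (r / ‖w‖)) fun ζ hζ =>
      (hd ζ (closure_ball_subset_closedBall hζ)).differentiableAt.differentiableWithinAt)
    (fun ζ hζ => hC _ (hmem ζ (sphere_subset_closedBall hζ)))
  rw [(hd 0 (mem_closedBall_self (by positivity))).deriv] at h2
  simp only [zero_smul, add_zero] at h2
  rwa [div_mul_eq_mul_div, ← div_div_eq_mul_div]

variable [FiniteDimensional ℂ F]

/-- Cauchy's formula on the complex lines in direction `v` writes the derivative as an integral of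
`f` over circles of one fixed radius, for all `x` near `x₀`. The integral is differentiated under
the sign: the Cauchy estimate dominates the integrand's derivative, for which measurability is
enough, so continuity of `fderiv` is not presupposed. -/
theorem differentiableAt_fderiv_apply_of_isOpen {f : F → ℂ} {U : Set F} (hU : IsOpen U)
    (hf : DifferentiableOn ℂ f U) {x₀ : F} (hx₀ : x₀ ∈ U) (v : F) :
    DifferentiableAt ℂ (fun x => fderiv ℂ f x v) x₀ := by
  have : ProperSpace F := FiniteDimensional.proper ℂ F
  obtain ⟨ε, hε, hεU⟩ := nhds_basis_closedBall.mem_iff.1 (hU.mem_nhds hx₀)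
  -- Three margins of size `r`: for moving the centre, for the circle, and for the Cauchy estimate
  -- at points of the circle.
  set r := ε / 3 with hr
  have hr0 : 0 < r := by positivity
  have hfd : ∀ y ∈ closedBall x₀ (3 * r), DifferentiableAt ℂ f y := fun y hy =>
    hf.differentiableAt (hU.mem_nhds (hεU (by convert hy using 2; ring)))
  obtain ⟨C, hC⟩ := (isCompact_closedBall x₀ (3 * r)).exists_bound_of_continuousOn
    (f := f) fun y hy => (hfd y hy).continuousAt.continuousWithinAt
  have hbound : ∀ y ∈ closedBall x₀ (2 * r), ‖fderiv ℂ f y‖ ≤ C / r := fun y hy => by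
    have hsub : closedBall y r ⊆ closedBall x₀ (3 * r) :=
      closedBall_subset_closedBall' (by rw [mem_closedBall] at hy; linarith)
    exact norm_fderiv_le_of_bounded hr0 (fun z hz => hfd z (hsub hz)) fun z hz => hC z (hsub hz)
  -- The `+ 1` covers `v = 0`.
  set R := r / (‖v‖ + 1) with hR
  have hR0 : 0 < R := by positivity
  have hRv : R * ‖v‖ ≤ r := by
    rw [hR, div_mul_eq_mul_div, div_le_iff₀ (by positivity)]; nlinarith [norm_nonneg v]
  have hmem : ∀ x ∈ closedBall x₀ r, ∀ ζ ∈ closedBall (0 : ℂ) R,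
      x + ζ • v ∈ closedBall x₀ (2 * r) := fun x hx ζ hζ => by
    rw [mem_closedBall_zero_iff] at hζ
    rw [mem_closedBall_iff_norm] at hx ⊢
    calc ‖x + ζ • v - x₀‖ = ‖(x - x₀) + ζ • v‖ := by congr 1; abel
      _ ≤ ‖x - x₀‖ + ‖ζ‖ * ‖v‖ := (norm_add_le _ _).trans_eq (by rw [norm_smul])
      _ ≤ r + R * ‖v‖ := by gcongr
      _ ≤ 2 * r := by linarith
  have h23 : closedBall x₀ (2 * r) ⊆ closedBall x₀ (3 * r) :=
    closedBall_subset_closedBall (by linarith)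
  have hline : ∀ x ∈ closedBall x₀ r, ∀ ζ ∈ closedBall (0 : ℂ) R,
      HasDerivAt (fun ζ : ℂ => f (x + ζ • v)) (fderiv ℂ f (x + ζ • v) v) ζ := fun x hx ζ hζ => by
    have h1 : HasDerivAt (fun ζ : ℂ => x + ζ • v) v ζ := by
      simpa using ((hasDerivAt_id ζ).smul_const v).const_add x
    exact (hfd _ (h23 (hmem x hx ζ hζ))).hasFDerivAt.comp_hasDerivAt ζ h1
  have hcirc : ∀ t, circleMap 0 R t ∈ closedBall (0 : ℂ) R := fun t =>
    sphere_subset_closedBall (circleMap_mem_sphere 0 hR0.le t)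
  let w : ℝ → ℂ := fun t => deriv (circleMap 0 R) t * ((circleMap 0 R t) ^ 2)⁻¹
  have hw : Continuous w := by
    have h0 : ∀ t, circleMap 0 R t ^ 2 ≠ 0 := fun t =>
      pow_ne_zero _ (circleMap_ne_center hR0.ne')
    simp only [w, deriv_circleMap]
    exact ((continuous_circleMap 0 R).mul continuous_const).mul
      (((continuous_circleMap 0 R).pow 2).inv₀ h0)
  have hrep : ∀ x ∈ ball x₀ r, fderiv ℂ f x v =
      (2 * Real.pi * Complex.I)⁻¹ • ∫ t in (0 : ℝ)..2 * Real.pi, w t • f (x + circleMap 0 R t • v) := by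
    intro x hx
    have hx' := ball_subset_closedBall hx
    have h1 := (hline x hx' 0 (mem_closedBall_self hR0.le)).deriv
    have hdc : DiffContOnCl ℂ (fun ζ : ℂ => f (x + ζ • v)) (ball 0 R) :=
      DifferentiableOn.diffContOnCl fun ζ hζ => (hline x hx' ζ
        (closure_ball_subset_closedBall hζ)).differentiableAt.differentiableWithinAt
    rw [zero_smul, add_zero] at h1
    rw [← h1, eq_inv_smul_iff₀ (by simp [Real.pi_ne_zero]), ← hdc.deriv_eq_smul_circleIntegral hR0]
    simp [circleIntegral, w, mul_assoc]
  have hcont : ∀ x ∈ closedBall x₀ r, Continuous fun t => w t • f (x + circleMap 0 R t • v) := by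
    intro x hx
    refine hw.smul (continuous_iff_continuousAt.2 fun t => ?_)
    have h1 : ContinuousAt (fun ζ : ℂ => f (x + ζ • v)) (circleMap 0 R t) :=
      (hline x hx _ (hcirc t)).continuousAt
    exact ContinuousAt.comp (f := circleMap 0 R) (g := fun ζ : ℂ => f (x + ζ • v)) h1
      (continuous_circleMap 0 R).continuousAt
  have key := intervalIntegral.hasFDerivAt_integral_of_dominated_of_fderiv_le (𝕜 := ℂ)
    (μ := MeasureTheory.volume) (a := 0) (b := 2 * Real.pi) (s := ball x₀ r) (x₀ := x₀)
    (F := fun x t => w t • f (x + circleMap 0 R t • v))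
    (F' := fun x t => w t • fderiv ℂ f (x + circleMap 0 R t • v))
    (bound := fun t => ‖w t‖ * (C / r)) (ball_mem_nhds x₀ hr0)
    (by
      filter_upwards [ball_mem_nhds x₀ hr0] with x hx
      exact (hcont x (ball_subset_closedBall hx)).aestronglyMeasurable)
    ((hcont x₀ (mem_closedBall_self hr0.le)).intervalIntegrable _ _)
    (by
      borelize F
      borelize (F →L[ℂ] ℂ)
      have hm : Measurable fun t => fderiv ℂ f (x₀ + circleMap 0 R t • v) :=
        (measurable_fderiv ℂ f).comp
          (continuous_const.add ((continuous_circleMap 0 R).smul continuous_const)).measurable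
      have : ProperSpace (F →L[ℂ] ℂ) := FiniteDimensional.proper ℂ _
      exact (hw.stronglyMeasurable.smul hm.stronglyMeasurable).aestronglyMeasurable)
    (Filter.Eventually.of_forall fun t _ x hx => by
      rw [norm_smul]
      gcongr
      exact hbound _ (hmem x (ball_subset_closedBall hx) _ (hcirc t)))
    ((hw.norm.mul continuous_const).intervalIntegrable _ _)
    (Filter.Eventually.of_forall fun t _ x hx => by
      have h1 : HasFDerivAt (fun x => x + circleMap 0 R t • v) (ContinuousLinearMap.id ℂ F) x :=
        (hasFDerivAt_id x).add_const _
      exact ((hfd _ (h23 (hmem x (ball_subset_closedBall hx) _ (hcirc t)))).hasFDerivAt.comp x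
        h1).const_smul (w t))
  refine (key.differentiableAt.const_smul ((2 * Real.pi * Complex.I)⁻¹ : ℂ)).congr_of_eventuallyEq ?_
  filter_upwards [ball_mem_nhds x₀ hr0] with x hx using hrep x hx

/-- A function of several complex variables that is complex differentiable on an open set is
smooth there. -/
theorem contDiffOn_of_differentiableOn_isOpen {f : F → ℂ} {U : Set F} (hU : IsOpen U)
    (hf : DifferentiableOn ℂ f U) : ContDiffOn ℂ ∞ f U := by
  rw [contDiffOn_infty]
  intro n
  induction n generalizing f with
  | zero => simpa using hf.continuousOn
  | succ n ih =>
    push_cast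
    rw [contDiffOn_succ_iff_fderiv_apply hU.uniqueDiffOn]
    refine ⟨hf, by simp, fun v => ?_⟩
    have h1 : DifferentiableOn ℂ (fun x => fderiv ℂ f x v) U := fun x hx =>
      (differentiableAt_fderiv_apply_of_isOpen hU hf hx v).differentiableWithinAt
    refine (ih h1).congr fun x hx => ?_
    rw [fderivWithin_of_isOpen hU hx]

end SeveralComplexVariables

/-! ### Linear algebra of metric traces -/

section InnerProducts

variable {E : Type*} [NormedAddCommGroup E] [NormedSpace ℝ E] [FiniteDimensional ℝ E]
  {V W : Type*} [NormedAddCommGroup V] [NormedSpace ℝ V] [NormedAddCommGroup W] [NormedSpace ℝ W]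
  {G : E →L[ℝ] E →L[ℝ] ℝ}

/-- A definite form is injective into a dual of the same dimension. This keeps `inverse` away from
its default value `0`. -/
theorem isInvertible_of_pos (hG : ∀ v, v ≠ 0 → 0 < G v v) : G.IsInvertible := by
  have hinj : Function.Injective (G : E →ₗ[ℝ] E →L[ℝ] ℝ) := by
    rw [injective_iff_map_eq_zero]
    intro v hv
    by_contra h
    have h1 := hG v h
    simp only [ContinuousLinearMap.coe_coe] at hv
    simp [hv] at h1
  have hdim : Module.finrank ℝ E = Module.finrank ℝ (E →L[ℝ] ℝ) := by
    rw [← Subspace.dual_finrank_eq (K := ℝ) (V := E)]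
    exact (LinearMap.toContinuousLinearMap (𝕜 := ℝ) (E := E) (F' := ℝ)).finrank_eq
  exact ⟨(LinearEquiv.ofInjectiveOfFinrankEq _ hinj hdim).toContinuousLinearEquiv, by ext; rfl⟩

theorem apply_inverse_of_pos (hG : ∀ v, v ≠ 0 → 0 < G v v) (α : E →L[ℝ] ℝ) :
    G (G.inverse α) = α := by
  obtain ⟨e, rfl⟩ := isInvertible_of_pos hG
  simp

theorem inverse_apply_of_pos (hG : ∀ v, v ≠ 0 → 0 < G v v) (v : E) : G.inverse (G v) = v := by
  obtain ⟨e, rfl⟩ := isInvertible_of_pos hG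
  simp

/-- Expansion of `α` in the dual basis. It turns traces of rank-one expressions into raising an
index; invertibility is not needed, since `G.inverse` is linear in any case. -/
theorem sum_apply_smul_inverse_coord (G : E →L[ℝ] E →L[ℝ] ℝ) (α : E →L[ℝ] ℝ) :
    ∑ j, α (Module.finBasis ℝ E j) •
      G.inverse (LinearMap.toContinuousLinearMap ((Module.finBasis ℝ E).coord j)) =
        G.inverse α := by
  have h1 : ∑ j, α (Module.finBasis ℝ E j) •
      LinearMap.toContinuousLinearMap ((Module.finBasis ℝ E).coord j) = α := by
    apply ContinuousLinearMap.coe_injective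
    refine (Module.finBasis ℝ E).ext fun k => ?_
    simp [Finsupp.single_apply]
  conv_rhs => rw [← h1]
  simp only [map_sum, map_smul]

theorem metricTrace_add {V : Type*} [NormedAddCommGroup V] (G : E →L[ℝ] E →L[ℝ] ℝ)
    (S T : E → E → V) :
    metricTrace G (fun u v => S u v + T u v) = metricTrace G S + metricTrace G T :=
  Finset.sum_add_distrib

theorem map_metricTrace (L : V →L[ℝ] W) (G : E →L[ℝ] E →L[ℝ] ℝ) (T : E → E → V) :
    L (metricTrace G T) = metricTrace G fun u v => L (T u v) := by
  simp [metricTrace]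

/-- The trace pairs a basis vector with a dual one, so it is not visibly symmetric. Splitting into
real and imaginary parts reduces the claim to `α (G⁻¹ β) = β (G⁻¹ α)`. -/
theorem metricTrace_mul_comm (hs : ∀ u v, G u v = G v u) (hG : ∀ v, v ≠ 0 → 0 < G v v)
    (a b : E →L[ℝ] ℂ) :
    metricTrace G (fun u v => a u * b v) = metricTrace G fun u v => b u * a v := by
  have h1 : ∀ (a b : E →L[ℝ] ℂ), metricTrace G (fun u v => a u * b v) =
      b (G.inverse (Complex.reCLM.comp a)) + Complex.I * b (G.inverse (Complex.imCLM.comp a)) := by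
    intro a b
    rw [← sum_apply_smul_inverse_coord, ← sum_apply_smul_inverse_coord]
    simp only [map_sum, map_smul, metricTrace, Finset.mul_sum, ← Finset.sum_add_distrib]
    refine Finset.sum_congr rfl fun j _ => ?_
    conv_lhs => rw [← Complex.re_add_im (a (Module.finBasis ℝ E j))]
    simp only [ContinuousLinearMap.comp_apply, Complex.reCLM_apply, Complex.imCLM_apply,
      Complex.real_smul]
    ring
  have h2 : ∀ α β : E →L[ℝ] ℝ, α (G.inverse β) = β (G.inverse α) := by
    intro α β
    conv_lhs => rw [← apply_inverse_of_pos hG α, hs, apply_inverse_of_pos hG β]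
  have h3 : ∀ (b : E →L[ℝ] ℂ) v, b v = (Complex.reCLM.comp b v : ℝ) +
      (Complex.imCLM.comp b v : ℝ) * Complex.I := by
    intro b v
    simp [Complex.re_add_im]
  rw [h1, h1, h3 b, h3 b, h3 a, h3 a, h2 (Complex.reCLM.comp b) (Complex.reCLM.comp a),
    h2 (Complex.imCLM.comp b) (Complex.reCLM.comp a),
    h2 (Complex.reCLM.comp b) (Complex.imCLM.comp a),
    h2 (Complex.imCLM.comp b) (Complex.imCLM.comp a)]
  ring

/-- The trace of a bilinear form on `ℂ = ℝ²` with respect to the flat metric. -/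
theorem metricTrace_flat {G : ℂ →L[ℝ] ℂ →L[ℝ] ℝ} (hG : ∀ u v, G u v = inner ℝ u v)
    (T : ℂ →L[ℝ] ℂ →L[ℝ] V) :
    metricTrace G (fun u v => T u v) = T 1 1 + T Complex.I Complex.I := by
  have hpos : ∀ v, v ≠ 0 → 0 < G v v := fun v hv => by
    rw [hG]; exact real_inner_self_pos.2 hv
  set e := Module.finBasis ℝ ℂ
  -- The basis `e` is arbitrary; its dual vectors are expanded in the orthonormal pair `1`, `I`.
  have h1 : ∀ j, G.inverse (LinearMap.toContinuousLinearMap (e.coord j)) =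
      e.coord j 1 • (1 : ℂ) + e.coord j Complex.I • Complex.I := by
    intro j
    have h2 := apply_inverse_of_pos hpos (LinearMap.toContinuousLinearMap (e.coord j))
    set f := G.inverse (LinearMap.toContinuousLinearMap (e.coord j))
    have h3 := fun v => DFunLike.congr_fun h2 v
    simp only [hG, LinearMap.coe_toContinuousLinearMap'] at h3
    rw [← h3, ← h3]
    apply Complex.ext <;> simp [Complex.inner]
  have h4 : ∀ u : ℂ, ∑ j, e.coord j u • T (e j) u = T u u := by
    intro u
    have h5 : T u = ∑ j, e.coord j u • T (e j) := by
      conv_lhs => rw [← e.sum_repr u]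
      simp only [map_sum, map_smul, Module.Basis.coord_apply]
    rw [h5]
    simp
  rw [← h4 1, ← h4 Complex.I, ← Finset.sum_add_distrib]
  refine Finset.sum_congr rfl fun j _ => ?_
  simp only [e, h1 j, map_add, map_smul]

end InnerProducts

/-! ### Isotropy and commutation with the complex structure -/

section Hermitian

variable {E : Type*} [NormedAddCommGroup E] [NormedSpace ℝ E] [FiniteDimensional ℝ E]
  {F : Type*} [NormedAddCommGroup F] [NormedSpace ℂ F]
  {V : Type*} [NormedAddCommGroup V] [NormedSpace ℂ V]
  {G : E →L[ℝ] E →L[ℝ] ℝ} {H : F →L[ℝ] F →L[ℝ] ℝ} {D : E →L[ℝ] F}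

/-- The `(2, 0)`-part of the inverse metric, pushed forward by `D`, vanishes: its contraction with
a complex covector is zero. -/
def IsIsotropic (G : E →L[ℝ] E →L[ℝ] ℝ) (D : E →L[ℝ] F) : Prop :=
  ∀ l : F →L[ℂ] ℂ, metricTrace G (fun u v => l (D u) • D v) = 0

/-- For `α = H w` the right side is `D D* w`, the operator that pseudo horizontal weak conformality
is about. -/
theorem metricTrace_smul_eq (G : E →L[ℝ] E →L[ℝ] ℝ) (D : E →L[ℝ] F) (α : F →L[ℝ] ℝ) :
    metricTrace G (fun u v => α (D u) • D v) = D (G.inverse (α.comp D)) := by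
  rw [← sum_apply_smul_inverse_coord]
  simp [metricTrace]

theorem metricTrace_complex_smul_eq (G : E →L[ℝ] E →L[ℝ] ℝ) (D : E →L[ℝ] F) {l : F → ℂ}
    {α β : F →L[ℝ] ℝ} (hl : ∀ v, l v = α v + β v * Complex.I) :
    metricTrace G (fun u v => l (D u) • D v) =
      D (G.inverse (α.comp D)) + Complex.I • D (G.inverse (β.comp D)) := by
  rw [← metricTrace_smul_eq, ← metricTrace_smul_eq]
  simp only [metricTrace, Finset.smul_sum, ← Finset.sum_add_distrib]
  refine Finset.sum_congr rfl fun j _ => ?_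
  rw [hl, add_smul, mul_comm, mul_smul, Complex.coe_smul, Complex.coe_smul]

theorem I_smul_right (hH : ∀ u v, H (Complex.I • u) (Complex.I • v) = H u v) (u v : F) :
    H u (Complex.I • v) = -H (Complex.I • u) v := by
  rw [← hH u, smul_smul, Complex.I_mul_I, neg_one_smul, map_neg]

/-- If `H w` represents the real part of `l`, complex linearity forces the imaginary part to be `H
(I • w)`. With `P = D D*` the contraction is then `P w + I • P (I • w)`, which vanishes when `P`
commutes with `I`. -/
theorem isIsotropic_of_commute [FiniteDimensional ℂ F] (hpos : ∀ v, v ≠ 0 → 0 < H v v)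
    (hH : ∀ u v, H (Complex.I • u) (Complex.I • v) = H u v)
    (hP : ∀ w, D (G.inverse ((H (Complex.I • w)).comp D)) =
      Complex.I • D (G.inverse ((H w).comp D))) : IsIsotropic G D := by
  intro l
  let α : F →L[ℝ] ℝ := Complex.reCLM.comp (l.restrictScalars ℝ)
  set w := H.inverse α with hw
  have hα : ∀ v, (l v).re = H w v := fun v => by rw [hw, apply_inverse_of_pos hpos]; rfl
  have hl : ∀ v, l v = (H w v : ℝ) + (H (Complex.I • w) v : ℝ) * Complex.I := by
    intro v
    have h1 := hα (Complex.I • v)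
    rw [I_smul_right hH, map_smul] at h1
    simp only [smul_eq_mul, Complex.mul_re, Complex.I_re, Complex.I_im, zero_mul, one_mul,
      zero_sub, neg_inj] at h1
    rw [← hα, ← h1, Complex.re_add_im]
  rw [metricTrace_complex_smul_eq G D hl, hP, smul_smul, Complex.I_mul_I, neg_one_smul,
    add_neg_cancel]

/-- For Hermitian `H` the form `H w + i H (I • w)` is complex linear, so isotropy applies to it and
yields `P w + I • P (I • w) = 0` with `P = D D*`. -/
theorem IsIsotropic.commute (hH : ∀ u v, H (Complex.I • u) (Complex.I • v) = H u v)
    (h : IsIsotropic G D) (w : F) :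
    D (G.inverse ((H (Complex.I • w)).comp D)) = Complex.I • D (G.inverse ((H w).comp D)) := by
  let l' : F →L[ℝ] ℂ :=
    Complex.ofRealCLM.comp (H w) + Complex.I • Complex.ofRealCLM.comp (H (Complex.I • w))
  have hl' : ∀ v, l' v = (H w v : ℝ) + (H (Complex.I • w) v : ℝ) * Complex.I := fun v => by
    simp [l', mul_comm]
  have hI : ∀ v, l' (Complex.I • v) = Complex.I • l' v := fun v => by
    rw [hl', hl', hH, I_smul_right hH]
    simp only [smul_eq_mul, mul_add, Complex.ofReal_neg]
    linear_combination ((H (Complex.I • w)) v : ℂ) * -Complex.I_sq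
  let l : F →L[ℂ] ℂ :=
    { toFun := l'
      map_add' := map_add l'
      map_smul' := fun c v => by
        conv_lhs => rw [← Complex.re_add_im c]
        rw [add_smul, map_add, mul_smul, Complex.coe_smul, Complex.coe_smul, map_smul, map_smul,
          hI]
        simp only [RingHom.id_apply, Complex.real_smul, smul_eq_mul]
        conv_rhs => rw [← Complex.re_add_im c]
        ring
      cont := l'.continuous }
  have h1 := h l
  rw [metricTrace_complex_smul_eq G D (l := l) hl'] at h1
  have h2 := congrArg (fun v => Complex.I • v) h1
  simp only [smul_add, smul_smul, Complex.I_mul_I, neg_one_smul, smul_zero] at h2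
  rw [← sub_eq_add_neg, sub_eq_zero] at h2
  exact h2.symm

theorem isIsotropic_of_mul (h : ∀ l m : F →L[ℂ] ℂ,
    metricTrace G (fun u v => l (D u) * m (D v)) = 0) : IsIsotropic G D := by
  intro l
  refine SeparatingDual.eq_zero_of_forall_dual_eq_zero (R := ℂ) fun m => ?_
  have h1 := map_metricTrace (m.restrictScalars ℝ) G (fun u v => l (D u) • D v)
  simp only [ContinuousLinearMap.coe_restrictScalars', map_smul, smul_eq_mul] at h1
  exact h1.trans (h l m)

/-- Polarization: the two cross terms in the trace of `(l + m)²` agree by `metricTrace_mul_comm`.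
Thus squares of linear functions suffice as test functions. -/
theorem isIsotropic_of_sq (hs : ∀ u v, G u v = G v u) (hG : ∀ v, v ≠ 0 → 0 < G v v)
    (h : ∀ l : F →L[ℂ] ℂ, metricTrace G (fun u v => l (D u) * l (D v)) = 0) :
    IsIsotropic G D := by
  refine isIsotropic_of_mul fun l m => ?_
  have h1 := h (l + m)
  have h2 := metricTrace_mul_comm hs hG ((l.restrictScalars ℝ).comp D)
    ((m.restrictScalars ℝ).comp D)
  simp only [ContinuousLinearMap.comp_apply, ContinuousLinearMap.coe_restrictScalars'] at h2
  have h3 : metricTrace G (fun u v => (l + m) (D u) * (l + m) (D v)) =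
      metricTrace G (fun u v => l (D u) * l (D v)) + metricTrace G (fun u v => m (D u) * m (D v)) +
      (metricTrace G (fun u v => l (D u) * m (D v)) +
        metricTrace G (fun u v => m (D u) * l (D v))) := by
    rw [← metricTrace_add, ← metricTrace_add, ← metricTrace_add]
    congr 1
    ext u v
    simp only [add_apply]
    ring
  rw [h3, h l, h m, ← h2, zero_add, zero_add, ← two_mul] at h1
  simpa using h1

/-- The trace of a complex bilinear map with respect to an isotropic `D` vanishes. -/
theorem IsIsotropic.metricTrace_eq_zero [FiniteDimensional ℂ F] (h : IsIsotropic G D)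
    (B : F →ₗ[ℝ] F →ₗ[ℝ] V)
    (hB₁ : ∀ u v, B (Complex.I • u) v = Complex.I • B u v)
    (hB₂ : ∀ u v, B u (Complex.I • v) = Complex.I • B u v) :
    metricTrace G (fun u v => B (D u) (D v)) = 0 := by
  have hc₁ : ∀ (c : ℂ) u v, B (c • u) v = c • B u v := fun c u v => by
    conv_lhs => rw [← Complex.re_add_im c]
    conv_rhs => rw [← Complex.re_add_im c]
    simp only [add_smul, mul_smul, Complex.coe_smul, map_add, map_smul, LinearMap.add_apply,
      LinearMap.smul_apply, hB₁]
  have hc₂ : ∀ (c : ℂ) u v, B u (c • v) = c • B u v := fun c u v => by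
    conv_lhs => rw [← Complex.re_add_im c]
    conv_rhs => rw [← Complex.re_add_im c]
    simp only [add_smul, mul_smul, Complex.coe_smul, map_add, map_smul, hB₂]
  let b := Module.finBasis ℂ F
  -- Complex bilinearity moves the coordinates of `u` into the second slot, where summing over the
  -- real basis of `E` produces the contraction that isotropy kills.
  have h1 : ∀ u v, B u v = ∑ k, B (b k) (b.coord k u • v) := fun u v => by
    conv_lhs => rw [← b.sum_repr u]
    rw [map_sum, LinearMap.sum_apply]
    simp only [hc₁, hc₂, Module.Basis.coord_apply]
  have h2 : ∀ k, ∑ j, B (b k) (b.coord k (D (Module.finBasis ℝ E j)) • D (G.inverse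
      (LinearMap.toContinuousLinearMap ((Module.finBasis ℝ E).coord j)))) = 0 := fun k => by
    have h3 := h (LinearMap.toContinuousLinearMap (b.coord k))
    simp only [metricTrace, LinearMap.coe_toContinuousLinearMap'] at h3
    rw [← map_sum, h3, map_zero]
  unfold metricTrace
  rw [Finset.sum_congr rfl fun j _ => h1 _ _, Finset.sum_comm]
  exact Finset.sum_eq_zero fun k _ => h2 k

end Hermitian

/-! ### Second derivatives of compositions -/

section Calculus

variable {E : Type*} [NormedAddCommGroup E] [NormedSpace ℝ E]
  {F : Type*} [NormedAddCommGroup F] [NormedSpace ℝ F]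
  {V : Type*} [NormedAddCommGroup V] [NormedSpace ℝ V]

/-- Stated near `y`, and not only at `y`, so that it can be differentiated again. The value `∞` is
excluded because being `C^∞` at a point need not persist nearby. -/
theorem fderiv_comp_eventuallyEq {K : F → V} {ψ : E → F} {y : E} {n : ℕ∞ω} (hn : 1 ≤ n) (hn' : n ≠ ∞)
    (hK : ContDiffAt ℝ n K (ψ y)) (hψ : ContDiffAt ℝ n ψ y) :
    fderiv ℝ (K ∘ ψ) =ᶠ[𝓝 y] fun y' => (fderiv ℝ K (ψ y')).comp (fderiv ℝ ψ y') := by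
  filter_upwards [hψ.eventually hn', hψ.continuousAt.eventually (hK.eventually hn')] with y' h1 h2
  exact fderiv_comp y' (h2.differentiableAt (by positivity)) (h1.differentiableAt (by positivity))

/-- The chain rule for second derivatives. -/
theorem fderiv_fderiv_comp {K : F → V} {ψ : E → F} {y : E}
    (hK : ContDiffAt ℝ 2 K (ψ y)) (hψ : ContDiffAt ℝ 2 ψ y) (u v : E) :
    fderiv ℝ (fderiv ℝ (K ∘ ψ)) y u v =
      fderiv ℝ (fderiv ℝ K) (ψ y) (fderiv ℝ ψ y u) (fderiv ℝ ψ y v) +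
        fderiv ℝ K (ψ y) (fderiv ℝ (fderiv ℝ ψ) y u v) := by
  rw [(fderiv_comp_eventuallyEq one_le_two (by simp) hK hψ).fderiv_eq]
  have h1 : DifferentiableAt ℝ (fderiv ℝ K) (ψ y) :=
    (hK.fderiv_right (m := 1) le_rfl).differentiableAt one_ne_zero
  have h2 : DifferentiableAt ℝ (fderiv ℝ ψ) y :=
    (hψ.fderiv_right (m := 1) le_rfl).differentiableAt one_ne_zero
  have h3 := (h1.hasFDerivAt.comp y (hψ.differentiableAt two_ne_zero).hasFDerivAt)
  have h4 := (h3.clm_comp h2.hasFDerivAt).fderiv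
  simp only [Function.comp_def] at h4
  rw [h4]
  simp [add_comm]

end Calculus

/-! ### Second derivatives of holomorphic functions -/

section Holomorphic

variable {F : Type*} [NormedAddCommGroup F] [NormedSpace ℂ F]
  {V : Type*} [NormedAddCommGroup V] [NormedSpace ℂ V]

/-- The second real derivative of a holomorphic function is complex linear in each variable. -/
theorem fderiv_fderiv_I_smul {K : F → V} {z : F} (hK : ∀ᶠ z' in 𝓝 z, DifferentiableAt ℂ K z')
    (hK2 : ContDiffAt ℝ 2 K z) (u v : F) :
    fderiv ℝ (fderiv ℝ K) z u (Complex.I • v) = Complex.I • fderiv ℝ (fderiv ℝ K) z u v := by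
  have h1 : DifferentiableAt ℝ (fderiv ℝ K) z :=
    (hK2.fderiv_right (m := 1) le_rfl).differentiableAt one_ne_zero
  -- The first derivative is complex linear on a whole neighbourhood, so this identity may be
  -- differentiated in the direction `u`.
  have h2 : (fun z' => fderiv ℝ K z' (Complex.I • v)) =ᶠ[𝓝 z]
      fun z' => Complex.I • fderiv ℝ K z' v := by
    filter_upwards [hK] with z' hz'
    rw [(hz'.hasFDerivAt.restrictScalars ℝ).fderiv]
    simp
  have h3 := h2.fderiv_eq (𝕜 := ℝ)
  have h4 := (h1.hasFDerivAt.clm_apply (hasFDerivAt_const (Complex.I • v) z)).fderiv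
  have h5 := ((h1.hasFDerivAt.clm_apply (hasFDerivAt_const v z)).const_smul Complex.I).fderiv
  have h6 := DFunLike.congr_fun (h4.symm.trans (h3.trans h5)) u
  simpa using h6

end Holomorphic

/-! ### Christoffel symbols and the Koszul formula -/

section Christoffel

variable {E : Type*} [NormedAddCommGroup E] [NormedSpace ℝ E]

theorem fderiv_apply_apply {G : E → E →L[ℝ] E →L[ℝ] ℝ} {y : E} (hG : DifferentiableAt ℝ G y) (u v w : E) :
    fderiv ℝ (fun y' => G y' v w) y u = fderiv ℝ G y u v w := by
  have h1 := ((hG.hasFDerivAt.clm_apply (hasFDerivAt_const v y)).clm_apply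
    (hasFDerivAt_const w y)).fderiv
  rw [h1]
  simp

theorem fderiv_symm_of_eventually {G : E → E →L[ℝ] E →L[ℝ] ℝ} {y : E} (hG : DifferentiableAt ℝ G y)
    (hs : ∀ᶠ y' in 𝓝 y, ∀ u v, G y' u v = G y' v u) (u v w : E) :
    fderiv ℝ G y u v w = fderiv ℝ G y u w v := by
  rw [← fderiv_apply_apply hG, ← fderiv_apply_apply hG]
  have h1 : (fun y' => G y' v w) =ᶠ[𝓝 y] fun y' => G y' w v := by
    filter_upwards [hs] with y' h using h v w
  rw [h1.fderiv_eq]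

/-- The right-hand side of the Koszul formula, as a covector. -/
def koszul (T : E →L[ℝ] E →L[ℝ] E →L[ℝ] ℝ) (u v : E) : E →L[ℝ] ℝ :=
  (1 / 2 : ℝ) • (T u v + T v u - (T.flip u).flip v)

theorem koszul_apply (T : E →L[ℝ] E →L[ℝ] E →L[ℝ] ℝ) (u v w : E) :
    koszul T u v w = 1 / 2 * (T u v w + T v u w - T w u v) := rfl

theorem koszul_add_left (T : E →L[ℝ] E →L[ℝ] E →L[ℝ] ℝ) (u₁ u₂ v : E) :
    koszul T (u₁ + u₂) v = koszul T u₁ v + koszul T u₂ v := by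
  ext w
  have h1 : T (u₁ + u₂) v w = T u₁ v w + T u₂ v w := by rw [T.map_add]; rfl
  have h2 : T v (u₁ + u₂) w = T v u₁ w + T v u₂ w := by rw [(T v).map_add]; rfl
  have h3 : T w (u₁ + u₂) v = T w u₁ v + T w u₂ v := by rw [(T w).map_add]; rfl
  rw [add_apply, koszul_apply, koszul_apply, koszul_apply, h1, h2, h3]
  ring

theorem koszul_smul_left (T : E →L[ℝ] E →L[ℝ] E →L[ℝ] ℝ) (c : ℝ) (u v : E) :
    koszul T (c • u) v = c • koszul T u v := by
  ext w
  have h1 : T (c • u) v w = c * T u v w := by rw [T.map_smul]; rfl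
  have h2 : T v (c • u) w = c * T v u w := by rw [(T v).map_smul]; rfl
  have h3 : T w (c • u) v = c * T w u v := by rw [(T w).map_smul]; rfl
  rw [smul_apply, koszul_apply, koszul_apply, h1, h2, h3, smul_eq_mul]
  ring

theorem koszul_add_right (T : E →L[ℝ] E →L[ℝ] E →L[ℝ] ℝ) (u v₁ v₂ : E) :
    koszul T u (v₁ + v₂) = koszul T u v₁ + koszul T u v₂ := by
  ext w
  have h1 : T (v₁ + v₂) u w = T v₁ u w + T v₂ u w := by rw [T.map_add]; rfl
  have h2 : T u (v₁ + v₂) w = T u v₁ w + T u v₂ w := by rw [(T u).map_add]; rfl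
  have h3 : T w u (v₁ + v₂) = T w u v₁ + T w u v₂ := (T w u).map_add v₁ v₂
  rw [add_apply, koszul_apply, koszul_apply, koszul_apply, h1, h2, h3]
  ring

theorem koszul_smul_right (T : E →L[ℝ] E →L[ℝ] E →L[ℝ] ℝ) (c : ℝ) (u v : E) :
    koszul T u (c • v) = c • koszul T u v := by
  ext w
  have h1 : T (c • v) u w = c * T v u w := by rw [T.map_smul]; rfl
  have h2 : T u (c • v) w = c * T u v w := by rw [(T u).map_smul]; rfl
  have h3 : T w u (c • v) = c * T w u v := (T w u).map_smul c v
  rw [smul_apply, koszul_apply, koszul_apply, h1, h2, h3, smul_eq_mul]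
  ring

set_option synthInstance.maxHeartbeats 200000 in
theorem christoffel_eq (G : E → E →L[ℝ] E →L[ℝ] ℝ) (y u v : E) :
    christoffel G y u v = (G y).inverse (koszul (fderiv ℝ G y) u v) := rfl

/-- The Christoffel symbols as a bilinear map. -/
def christoffelBilin (G : E → E →L[ℝ] E →L[ℝ] ℝ) (y : E) : E →ₗ[ℝ] E →ₗ[ℝ] E :=
  LinearMap.mk₂ ℝ (christoffel G y)
    (fun u₁ u₂ v => by
      rw [christoffel_eq, koszul_add_left, ContinuousLinearMap.map_add]; rfl)
    (fun c u v => by rw [christoffel_eq, koszul_smul_left, ContinuousLinearMap.map_smul]; rfl)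
    (fun u v₁ v₂ => by
      rw [christoffel_eq, koszul_add_right, ContinuousLinearMap.map_add]; rfl)
    (fun c u v => by rw [christoffel_eq, koszul_smul_right, ContinuousLinearMap.map_smul]; rfl)

theorem christoffel_comm {G : E → E →L[ℝ] E →L[ℝ] ℝ} {y : E} (hG : DifferentiableAt ℝ G y)
    (hs : ∀ᶠ y' in 𝓝 y, ∀ u v, G y' u v = G y' v u) (u v : E) :
    christoffel G y u v = christoffel G y v u := by
  rw [christoffel_eq, christoffel_eq]
  congr 1
  ext w
  rw [koszul_apply, koszul_apply, fderiv_symm_of_eventually hG hs w u v]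
  ring

theorem apply_christoffel [FiniteDimensional ℝ E] {G : E → E →L[ℝ] E →L[ℝ] ℝ} {y : E}
    (hpos : ∀ v, v ≠ 0 → 0 < G y v v) (u v w : E) :
    G y (christoffel G y u v) w =
      1 / 2 * (fderiv ℝ G y u v w + fderiv ℝ G y v u w - fderiv ℝ G y w u v) := by
  rw [christoffel_eq, apply_inverse_of_pos hpos, koszul_apply]

end Christoffel

/-! ### Christoffel symbols of a Kähler metric -/

section Kahler

variable {F : Type*} [NormedAddCommGroup F] [NormedSpace ℂ F]

set_option synthInstance.maxHeartbeats 200000 in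
/-- The Christoffel symbols of a Kähler metric are complex linear. -/
theorem christoffel_I_smul [FiniteDimensional ℂ F] {G : F → F →L[ℝ] F →L[ℝ] ℝ} {z : F}
    (hG : DifferentiableAt ℝ G z)
    (hs : ∀ᶠ y in 𝓝 z, ∀ u v, G y u v = G y v u)
    (hpos : ∀ v, v ≠ 0 → 0 < G z v v)
    (hI : ∀ᶠ y in 𝓝 z, ∀ u v, G y (Complex.I • u) (Complex.I • v) = G y u v)
    (hd : ∀ u v w, fderiv ℝ G z u (Complex.I • v) w + fderiv ℝ G z v (Complex.I • w) u +
      fderiv ℝ G z w (Complex.I • u) v = 0) (u v : F) :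
    christoffel G z (Complex.I • u) v = Complex.I • christoffel G z u v := by
  have hT := fderiv_symm_of_eventually hG hs
  have hTI : ∀ u v w, fderiv ℝ G z u (Complex.I • v) (Complex.I • w) = fderiv ℝ G z u v w := by
    intro u v w
    rw [← fderiv_apply_apply hG, ← fderiv_apply_apply hG]
    have h1 : (fun y' => G y' (Complex.I • v) (Complex.I • w)) =ᶠ[𝓝 z] fun y' => G y' v w := by
      filter_upwards [hI] with y' h using h v w
    rw [h1.fderiv_eq]
  have hII : ∀ v : F, Complex.I • Complex.I • v = -v := fun v => by
    rw [smul_smul, Complex.I_mul_I, neg_one_smul]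
  have hI0 := hI.self_of_nhds
  have hTneg : ∀ u v w, fderiv ℝ G z u (Complex.I • v) w = -fderiv ℝ G z u v (Complex.I • w) := by
    intro u v w
    rw [← hTI u (Complex.I • v) w, hII, map_neg]
    simp
  have hinj : ∀ a b, G z a = G z b → a = b := fun a b hab => by
    rw [← inverse_apply_of_pos hpos a, hab, inverse_apply_of_pos hpos]
  apply hinj
  ext w
  have hrot : G z (Complex.I • christoffel G z u v) w =
      -G z (christoffel G z u v) (Complex.I • w) := by
    rw [I_smul_right hI0, neg_neg]
  rw [hrot]
  rw [apply_christoffel hpos, apply_christoffel hpos]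
  -- Closedness enters twice, at `(I u, I w, v)` here and at `(u, v, w)` below. Moving `I` across
  -- the differentiated metric makes the two Koszul expressions differ by a combination of these.
  have e1 : -fderiv ℝ G z (Complex.I • u) w v + fderiv ℝ G z (Complex.I • w) v u -
      fderiv ℝ G z v u (Complex.I • w) = 0 := by
    have e2 := hd (Complex.I • u) (Complex.I • w) v
    have e3 : fderiv ℝ G z (Complex.I • u) (-w) v = -fderiv ℝ G z (Complex.I • u) w v := by
      rw [(fderiv ℝ G z (Complex.I • u)).map_neg]; rfl
    have e4 : fderiv ℝ G z v (-u) (Complex.I • w) = -fderiv ℝ G z v u (Complex.I • w) := by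
      rw [(fderiv ℝ G z v).map_neg]; rfl
    rw [hTI, hII, hII, e3, e4] at e2
    linarith
  linarith [hd u v w, hTneg v u w, hTneg u v w, hT (Complex.I • u) w v, hT (Complex.I • w) v u,
    hT v (Complex.I • w) u]

end Kahler

/-! ### The metric in a chart -/

section ChartMetric

variable {E : Type*} [NormedAddCommGroup E] [NormedSpace ℝ E]
  {M : Type*} [TopologicalSpace M] [ChartedSpace E M]

theorem extChartAt_symm_tendsto (x : M) :
    Tendsto (extChartAt 𝓘(ℝ, E) x).symm (𝓝 (extChartAt 𝓘(ℝ, E) x x)) (𝓝 x) := by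
  simpa using (continuousAt_extChartAt_symm (I := 𝓘(ℝ, E)) x).tendsto

theorem extChartAt_target_mem_nhds_self (x : M) :
    (extChartAt 𝓘(ℝ, E) x).target ∈ 𝓝 (extChartAt 𝓘(ℝ, E) x x) :=
  extChartAt_target_mem_nhds x

variable [IsManifold 𝓘(ℝ, E) ∞ M]

theorem chartMetric_apply (g : SmoothMetric E M) (x : M) (y u v : E) :
    chartMetric g x y u v = g.inner ((extChartAt 𝓘(ℝ, E) x).symm y)
      (mfderiv 𝓘(ℝ, E) 𝓘(ℝ, E) (extChartAt 𝓘(ℝ, E) x).symm y u)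
      (mfderiv 𝓘(ℝ, E) 𝓘(ℝ, E) (extChartAt 𝓘(ℝ, E) x).symm y v) := rfl

theorem chartMetric_symm (g : SmoothMetric E M) (x : M) (y u v : E) :
    chartMetric g x y u v = chartMetric g x y v u := by
  rw [chartMetric_apply, chartMetric_apply, g.symm]

/-- In the preferred chart at `x`, the metric at the centre is the metric at `x`. -/
theorem chartMetric_self (g : SmoothMetric E M) (x : M) :
    chartMetric g x (extChartAt 𝓘(ℝ, E) x x) = (g.inner x : E →L[ℝ] E →L[ℝ] ℝ) := by
  have : IsManifold 𝓘(ℝ, E) 1 M := .of_le (n := ∞) (by simp)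
  have h1 := mfderivWithin_range_extChartAt_symm (I := 𝓘(ℝ, E)) (x := x)
  rw [modelWithCornersSelf_coe, range_id, mfderivWithin_univ] at h1
  have h2 : ∀ (u : E), (mfderiv 𝓘(ℝ, E) 𝓘(ℝ, E) (extChartAt 𝓘(ℝ, E) x).symm
      (extChartAt 𝓘(ℝ, E) x x) : E →L[ℝ] E) u = u := fun u => DFunLike.congr_fun h1 u
  -- The base point equals `x` only propositionally and the fibre depends on it, so the equality is
  -- eliminated for a general `p`.
  have h3 : ∀ p : M, p = x → (g.inner p : E →L[ℝ] E →L[ℝ] ℝ) = g.inner x := by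
    rintro p rfl; rfl
  have h4 := h3 _ (extChartAt_to_inv (I := 𝓘(ℝ, E)) x)
  refine ContinuousLinearMap.ext fun u => ContinuousLinearMap.ext fun v => ?_
  rw [chartMetric_apply]
  erw [h2 u, h2 v]
  exact DFunLike.congr_fun (DFunLike.congr_fun h4 u) v

theorem chartMetric_pos (g : SmoothMetric E M) (x : M) (v : E) (hv : v ≠ 0) :
    0 < chartMetric g x (extChartAt 𝓘(ℝ, E) x x) v v := by
  rw [chartMetric_self]
  exact g.pos x v hv

/-- Smoothness of `g` is smoothness in the trivialization of a bundle of bilinear forms. The tangent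
trivialization at `x` is inverted by the derivative of the inverse chart, so the trivialized metric
is `chartMetric` on the chart's target. -/
theorem differentiableAt_chartMetric (g : SmoothMetric E M) (x : M) :
    DifferentiableAt ℝ (chartMetric g x) (extChartAt 𝓘(ℝ, E) x x) := by
  have : IsManifold 𝓘(ℝ, E) 1 M := .of_le (n := ∞) (by simp)
  have h1 := ((contMDiffAt_hom_bundle _).1 (g.contMDiff x)).2
  have h2 := (contMDiffAt_iff.1 h1).2
  rw [modelWithCornersSelf_coe, range_id, contDiffWithinAt_univ] at h2
  have h3 := h2.differentiableAt (by simp)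
  refine h3.congr_of_eventuallyEq ?_
  filter_upwards [extChartAt_target_mem_nhds_self x] with y hy
  set p := (extChartAt 𝓘(ℝ, E) x).symm y with hp
  have hps : p ∈ (chartAt E x).source := by
    rw [← extChartAt_source 𝓘(ℝ, E)]; exact (extChartAt 𝓘(ℝ, E) x).map_target hy
  have hA := TangentBundle.symmL_trivializationAt (I := 𝓘(ℝ, E)) hps
  rw [modelWithCornersSelf_coe, range_id, mfderivWithin_univ,
    (extChartAt 𝓘(ℝ, E) x).right_inv hy] at hA
  refine ContinuousLinearMap.ext fun u => ContinuousLinearMap.ext fun v => ?_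
  rw [chartMetric_apply]
  have hA' : ∀ u : E, (trivializationAt E (TangentSpace 𝓘(ℝ, E)) x).symm p u =
      (mfderiv 𝓘(ℝ, E) 𝓘(ℝ, E) (extChartAt 𝓘(ℝ, E) x).symm y u) := fun u =>
    (Trivialization.symmL_apply (R := ℝ) _ hps u).symm.trans (DFunLike.congr_fun hA u)
  have h5 := inCoordinates_apply_eq₂ (F₁ := E) (F₂ := E) (F₃ := ℝ)
    (E₁ := fun x : M => TangentSpace 𝓘(ℝ, E) x) (E₂ := fun x : M => TangentSpace 𝓘(ℝ, E) x)
    (E₃ := Bundle.Trivial M ℝ) (x₀ := x) (x := p) (ϕ := g.inner p) (v := u) (w := v) hps hps (mem_univ _)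
  rw [hA', hA'] at h5
  refine Eq.trans ?_ h5.symm
  exact (DFunLike.congr_fun (Bundle.Trivial.linearMapAt_trivialization ℝ M ℝ p) _).symm

end ChartMetric

/-! ### Hermitian and Kähler metrics in holomorphic charts -/

section HermitianChart

variable {F : Type*} [NormedAddCommGroup F] [NormedSpace ℂ F]
  {N : Type*} [TopologicalSpace N] [ChartedSpace F N] [IsManifold 𝓘(ℂ, F) ω N]

/-- The charts are holomorphic, so the real derivative of the inverse chart is the restriction of
scalars of a complex linear map. -/
theorem mfderiv_extChartAt_symm_I_smul (p : N) {y : F} (hy : y ∈ (extChartAt 𝓘(ℝ, F) p).target)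
    (v : F) :
    mfderiv 𝓘(ℝ, F) 𝓘(ℝ, F) (extChartAt 𝓘(ℝ, F) p).symm y (Complex.I • v) =
      complexStructure _ (mfderiv 𝓘(ℝ, F) 𝓘(ℝ, F) (extChartAt 𝓘(ℝ, F) p).symm y v) := by
  have : IsManifold 𝓘(ℂ, F) 1 N := .of_le (n := ω) (by simp)
  have h1 := mdifferentiableWithinAt_extChartAt_symm (I := 𝓘(ℂ, F)) (x := p) (z := y) hy
  rw [modelWithCornersSelf_coe, range_id, mdifferentiableWithinAt_univ] at h1
  obtain ⟨hc, hd⟩ := h1.hasMFDerivAt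
  have h2 : HasMFDerivAt 𝓘(ℝ, F) 𝓘(ℝ, F) (extChartAt 𝓘(ℝ, F) p).symm y
      ((mfderiv 𝓘(ℂ, F) 𝓘(ℂ, F) (extChartAt 𝓘(ℂ, F) p).symm y : F →L[ℂ] F).restrictScalars ℝ) :=
    ⟨hc, hd.restrictScalars ℝ⟩
  rw [h2.mfderiv]
  exact (mfderiv 𝓘(ℂ, F) 𝓘(ℂ, F) (extChartAt 𝓘(ℂ, F) p).symm y : F →L[ℂ] F).map_smul Complex.I v

theorem IsHermitianMetric.chartMetric_I_smul {h : SmoothMetric F N} (hh : IsHermitianMetric h)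
    (p : N) {y : F} (hy : y ∈ (extChartAt 𝓘(ℝ, F) p).target) (u v : F) :
    chartMetric h p y (Complex.I • u) (Complex.I • v) = chartMetric h p y u v := by
  rw [chartMetric_apply, mfderiv_extChartAt_symm_I_smul p hy, mfderiv_extChartAt_symm_I_smul p hy,
    hh]
  rfl

theorem IsKahlerMetric.christoffel_I_smul [FiniteDimensional ℂ F] {h : SmoothMetric F N}
    (hh : IsKahlerMetric h) (p : N) (u v : F) :
    christoffel (chartMetric h p) (extChartAt 𝓘(ℝ, F) p p) (Complex.I • u) v =
      Complex.I • christoffel (chartMetric h p) (extChartAt 𝓘(ℝ, F) p p) u v := by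
  have hG := differentiableAt_chartMetric h p
  refine PHM.christoffel_I_smul hG (.of_forall fun y => chartMetric_symm h p y)
    (chartMetric_pos h p) ?_ (fun u v w => ?_) u v
  · filter_upwards [extChartAt_target_mem_nhds_self p] with y hy using hh.1.chartMetric_I_smul p hy
  · have h1 := hh.2 p u v w
    simp only [chartFundamentalForm] at h1
    rwa [fderiv_apply_apply hG, fderiv_apply_apply hG, fderiv_apply_apply hG] at h1

end HermitianChart

/-! ### The Laplacian in coordinates and its composition law -/

section LocalLaplacian

theorem contDiffAt_comp_extChartAt_symm {E : Type*} [NormedAddCommGroup E] [NormedSpace ℝ E]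
    {V : Type*} [NormedAddCommGroup V] [NormedSpace ℝ V] {M : Type*} [TopologicalSpace M]
    [ChartedSpace E M] {f : M → V} {x : M} {n : ℕ∞ω}
    (hf : ContMDiffAt 𝓘(ℝ, E) 𝓘(ℝ, V) n f x) :
    ContDiffAt ℝ n (f ∘ (extChartAt 𝓘(ℝ, E) x).symm) (extChartAt 𝓘(ℝ, E) x x) := by
  have h2 := (contMDiffAt_iff.1 hf).2
  rw [modelWithCornersSelf_coe, range_id, contDiffWithinAt_univ] at h2
  exact h2

variable {E : Type*} [NormedAddCommGroup E] [NormedSpace ℝ E] [FiniteDimensional ℝ E]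
  {F : Type*} [NormedAddCommGroup F] [NormedSpace ℝ F]
  {V : Type*} [NormedAddCommGroup V] [NormedSpace ℝ V]

/-- The Laplace-Beltrami operator of a metric `G` on an open subset of a vector space. -/
def localLaplacian (G : E → E →L[ℝ] E →L[ℝ] ℝ) (ψ : E → V) (y : E) : V :=
  metricTrace (G y) fun u v =>
    fderiv ℝ (fderiv ℝ ψ) y u v - fderiv ℝ ψ y (christoffel G y u v)

theorem localLaplacian_congr (G : E → E →L[ℝ] E →L[ℝ] ℝ) {ψ₁ ψ₂ : E → V} {y : E}
    (h : ψ₁ =ᶠ[𝓝 y] ψ₂) : localLaplacian G ψ₁ y = localLaplacian G ψ₂ y := by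
  unfold localLaplacian
  rw [h.fderiv_eq, h.fderiv.fderiv_eq]

/-- The composition law for the Laplace-Beltrami operator. -/
theorem localLaplacian_comp (G : E → E →L[ℝ] E →L[ℝ] ℝ) {K : F → V} {ψ : E → F} {y : E}
    (hK : ContDiffAt ℝ 2 K (ψ y)) (hψ : ContDiffAt ℝ 2 ψ y) :
    localLaplacian G (K ∘ ψ) y = fderiv ℝ K (ψ y) (localLaplacian G ψ y) +
      metricTrace (G y) fun u v =>
        fderiv ℝ (fderiv ℝ K) (ψ y) (fderiv ℝ ψ y u) (fderiv ℝ ψ y v) := by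
  unfold localLaplacian
  rw [map_metricTrace, ← metricTrace_add]
  congr 1
  ext u v
  rw [fderiv_fderiv_comp hK hψ, fderiv_comp y (hK.differentiableAt two_ne_zero)
    (hψ.differentiableAt two_ne_zero), map_sub, ContinuousLinearMap.comp_apply]
  abel

theorem localLaplacian_clm_comp (G : E → E →L[ℝ] E →L[ℝ] ℝ) (L : F →L[ℝ] V) {ψ : E → F} {y : E}
    (hψ : ContDiffAt ℝ 2 ψ y) : localLaplacian G (L ∘ ψ) y = L (localLaplacian G ψ y) := by
  rw [localLaplacian_comp G L.contDiff.contDiffAt hψ]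
  have h1 : fderiv ℝ (fderiv ℝ L) = 0 := by
    have : fderiv ℝ L = fun _ => L := by ext1 x; exact L.fderiv
    rw [this]
    ext1 x
    simp
  rw [h1, L.fderiv]
  simp [metricTrace]

variable {M : Type*} [TopologicalSpace M] [ChartedSpace E M] [IsManifold 𝓘(ℝ, E) ∞ M]

theorem laplaceBeltrami_eq (g : SmoothMetric E M) (f : M → V) (x : M) :
    laplaceBeltrami g f x = localLaplacian (chartMetric g x) (f ∘ (extChartAt 𝓘(ℝ, E) x).symm)
      (extChartAt 𝓘(ℝ, E) x x) := rfl

theorem laplaceBeltrami_comp (g : SmoothMetric E M) {k : F → V} {ψ : M → F} {x : M}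
    (hk : ContDiffAt ℝ 2 k (ψ x)) (hψ : ContMDiffAt 𝓘(ℝ, E) 𝓘(ℝ, F) 2 ψ x) :
    laplaceBeltrami g (k ∘ ψ) x = fderiv ℝ k (ψ x) (laplaceBeltrami g ψ x) +
      metricTrace (chartMetric g x (extChartAt 𝓘(ℝ, E) x x)) fun u v =>
        fderiv ℝ (fderiv ℝ k) (ψ x)
          (fderiv ℝ (ψ ∘ (extChartAt 𝓘(ℝ, E) x).symm) (extChartAt 𝓘(ℝ, E) x x) u)
          (fderiv ℝ (ψ ∘ (extChartAt 𝓘(ℝ, E) x).symm) (extChartAt 𝓘(ℝ, E) x x) v) := by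
  have h1 : (ψ ∘ (extChartAt 𝓘(ℝ, E) x).symm) (extChartAt 𝓘(ℝ, E) x x) = ψ x := by simp
  have h2 := localLaplacian_comp (chartMetric g x) (K := k)
    (ψ := ψ ∘ (extChartAt 𝓘(ℝ, E) x).symm) (y := extChartAt 𝓘(ℝ, E) x x) (by rwa [h1])
    (contDiffAt_comp_extChartAt_symm hψ)
  rw [h1] at h2
  exact h2

end LocalLaplacian

/-! ### Harmonic functions on the flat plane -/

section Flat

theorem chartMetric_flatMetric (w y u v : ℂ) : chartMetric flatMetric w y u v = inner ℝ u v := by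
  have h1 : ((extChartAt 𝓘(ℝ, ℂ) w).symm : ℂ → ℂ) = id := by
    rw [extChartAt_model_space_eq_id]
    rfl
  have h2 : (mfderiv 𝓘(ℝ, ℂ) 𝓘(ℝ, ℂ) (extChartAt 𝓘(ℝ, ℂ) w).symm y : ℂ →L[ℝ] ℂ) =
      ContinuousLinearMap.id ℝ ℂ := by
    refine Eq.trans mfderiv_eq_fderiv ?_
    rw [h1, fderiv_id]
  have h3 : chartMetric flatMetric w y u v = inner ℝ
      ((mfderiv 𝓘(ℝ, ℂ) 𝓘(ℝ, ℂ) (extChartAt 𝓘(ℝ, ℂ) w).symm y : ℂ →L[ℝ] ℂ) u)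
      ((mfderiv 𝓘(ℝ, ℂ) 𝓘(ℝ, ℂ) (extChartAt 𝓘(ℝ, ℂ) w).symm y : ℂ →L[ℝ] ℂ) v) := rfl
  rw [h3, h2]
  rfl

/-- A symmetric bilinear form on `ℂ` with vanishing flat trace is the real part of a complex
multiple of the complex product. -/
theorem eq_re_mul_of_flat_trace_eq_zero {B : ℂ →L[ℝ] ℂ →L[ℝ] ℝ} (hs : ∀ z w, B z w = B w z)
    (ht : B 1 1 + B Complex.I Complex.I = 0) (z w : ℂ) :
    B z w = ((⟨B 1 1, -B 1 Complex.I⟩ : ℂ) * (z * w)).re := by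
  have h1 : ∀ z : ℂ, z = z.re • (1 : ℂ) + z.im • Complex.I := fun z => by
    simp [Complex.re_add_im]
  conv_lhs => rw [h1 z, h1 w]
  simp only [map_add, map_smul, add_apply, smul_apply, smul_eq_mul]
  rw [hs Complex.I 1]
  simp
  linear_combination (z.im * w.im) * ht

/-- The flat metric is constant in the identity chart, so the Christoffel term drops out. -/
theorem HarmonicOn.flat {k : ℂ → ℝ} {W : Set ℂ} (hW : IsOpen W) (hk : HarmonicOn flatMetric k W)
    {w : ℂ} (hw : w ∈ W) :
    ContDiffAt ℝ 2 k w ∧ fderiv ℝ (fderiv ℝ k) w 1 1 +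
      fderiv ℝ (fderiv ℝ k) w Complex.I Complex.I = 0 := by
  refine ⟨(hk.1.contDiffOn w hw).contDiffAt (hW.mem_nhds hw), ?_⟩
  have h1 := hk.2 w hw
  have h2 : ∀ y u v, christoffel (chartMetric flatMetric w) y u v = 0 := by
    intro y u v
    have h3 : chartMetric flatMetric w = fun _ => chartMetric flatMetric w y := by
      ext y' u v
      rw [chartMetric_flatMetric, chartMetric_flatMetric]
    have h4 : fderiv ℝ (chartMetric flatMetric w) y = 0 := by
      rw [h3]; simp
    unfold christoffel
    rw [h4]
    simp
  rw [laplaceBeltrami_eq, localLaplacian] at h1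
  simp only [h2, map_zero, sub_zero] at h1
  simp only [extChartAt_model_space_eq_id, PartialEquiv.refl_symm, PartialEquiv.refl_coe,
    Function.comp_id, id_eq] at h1
  rw [metricTrace_flat (chartMetric_flatMetric w w)] at h1
  exact h1

end Flat

/-! ### Harmonic morphisms into the plane -/

section HarmonicMorphism

variable {E : Type*} [NormedAddCommGroup E] [NormedSpace ℝ E] [FiniteDimensional ℝ E]
  {M : Type*} [TopologicalSpace M] [ChartedSpace E M] [IsManifold 𝓘(ℝ, E) ∞ M]

/-- The square `⟨dψ, dψ⟩` of the complex differential of `ψ : M → ℂ`, with respect to the complex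
bilinear extension of the metric. -/
def complexGradSq (g : SmoothMetric E M) (ψ : M → ℂ) (x : M) : ℂ :=
  metricTrace (chartMetric g x (extChartAt 𝓘(ℝ, E) x x)) fun u v =>
    fderiv ℝ (ψ ∘ (extChartAt 𝓘(ℝ, E) x).symm) (extChartAt 𝓘(ℝ, E) x x) u *
      fderiv ℝ (ψ ∘ (extChartAt 𝓘(ℝ, E) x).symm) (extChartAt 𝓘(ℝ, E) x x) v

/-- A harmonic function whose differential is isotropic is a harmonic morphism. -/
theorem isHarmonicMorphismOn_of_complexGradSq {g : SmoothMetric E M} {ψ : M → ℂ} {U : Set M}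
    (hU : IsOpen U) (hψ : ContMDiffOn 𝓘(ℝ, E) 𝓘(ℝ, ℂ) ∞ ψ U)
    (hΔ : ∀ x ∈ U, laplaceBeltrami g ψ x = 0) (hgrad : ∀ x ∈ U, complexGradSq g ψ x = 0) :
    IsHarmonicMorphismOn g flatMetric ψ U := by
  refine ⟨hψ, fun W k hW hk => ⟨?_, ?_⟩⟩
  · exact hk.1.comp ((hψ.of_le ENat.LEInfty.out).mono inter_subset_left) fun x hx => hx.2
  · rintro x ⟨hxU, hxW⟩
    obtain ⟨hk2, ht⟩ := hk.flat hW hxW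
    have hψx : ContMDiffAt 𝓘(ℝ, E) 𝓘(ℝ, ℂ) 2 ψ x :=
      ((hψ x hxU).contMDiffAt (hU.mem_nhds hxU)).of_le ENat.LEInfty.out
    have hs : IsSymmSndFDerivAt ℝ k (ψ x) := hk2.isSymmSndFDerivAt (by simp)
    rw [laplaceBeltrami_comp g hk2 hψx, hΔ x hxU, map_zero, zero_add]
    -- With this `c` the Hessian of `k` is `Re(c z w)`, so the remaining trace is `Re(c ⟨dψ, dψ⟩)`.
    set c : ℂ := ⟨fderiv ℝ (fderiv ℝ k) (ψ x) 1 1, -fderiv ℝ (fderiv ℝ k) (ψ x) 1 Complex.I⟩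
    have h1 := map_metricTrace (Complex.reCLM.comp (c • ContinuousLinearMap.id ℝ ℂ))
      (chartMetric g x (extChartAt 𝓘(ℝ, E) x x)) fun u v =>
        fderiv ℝ (ψ ∘ (extChartAt 𝓘(ℝ, E) x).symm) (extChartAt 𝓘(ℝ, E) x x) u *
          fderiv ℝ (ψ ∘ (extChartAt 𝓘(ℝ, E) x).symm) (extChartAt 𝓘(ℝ, E) x x) v
    have h2 := hgrad x hxU
    rw [complexGradSq] at h2
    rw [h2, map_zero] at h1
    rw [h1]
    congr 1
    ext u v
    exact eq_re_mul_of_flat_trace_eq_zero (fun z w => hs z w) ht _ _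

theorem laplaceBeltrami_conj (g : SmoothMetric E M) {ψ : M → ℂ} {x : M}
    (hψ : ContMDiffAt 𝓘(ℝ, E) 𝓘(ℝ, ℂ) 2 ψ x) :
    laplaceBeltrami g (fun p => conj (ψ p)) x = conj (laplaceBeltrami g ψ x) :=
  localLaplacian_clm_comp (chartMetric g x) (Complex.conjCLE : ℂ →L[ℝ] ℂ)
    (contDiffAt_comp_extChartAt_symm hψ)

theorem complexGradSq_conj (g : SmoothMetric E M) {ψ : M → ℂ} {x : M}
    (hψ : ContMDiffAt 𝓘(ℝ, E) 𝓘(ℝ, ℂ) 2 ψ x) :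
    complexGradSq g (fun p => conj (ψ p)) x = conj (complexGradSq g ψ x) := by
  have h1 : fderiv ℝ ((fun p => conj (ψ p)) ∘ (extChartAt 𝓘(ℝ, E) x).symm)
      (extChartAt 𝓘(ℝ, E) x x) = (Complex.conjCLE : ℂ →L[ℝ] ℂ).comp
        (fderiv ℝ (ψ ∘ (extChartAt 𝓘(ℝ, E) x).symm) (extChartAt 𝓘(ℝ, E) x x)) :=
    ((Complex.conjCLE : ℂ →L[ℝ] ℂ).hasFDerivAt.comp _
      ((contDiffAt_comp_extChartAt_symm hψ).differentiableAt two_ne_zero).hasFDerivAt).fderiv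
  unfold complexGradSq
  rw [h1]
  refine Eq.trans ?_ (map_metricTrace (Complex.conjCLE : ℂ →L[ℝ] ℂ) _ _).symm
  congr 1
  ext u v
  simp

end HarmonicMorphism

/-! ### Holomorphic functions on complex manifolds -/

section Holomorphic

variable {F : Type*} [NormedAddCommGroup F] [NormedSpace ℂ F]
  {N : Type*} [TopologicalSpace N] [ChartedSpace F N]

theorem differentiableOn_comp_symm {f : N → ℂ} {U : Set N}
    [IsManifold 𝓘(ℂ, F) ω N] (hf : MDifferentiableOn 𝓘(ℂ, F) 𝓘(ℂ, ℂ) f U) (p : N) :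
    DifferentiableOn ℂ (f ∘ (extChartAt 𝓘(ℝ, F) p).symm)
      ((extChartAt 𝓘(ℝ, F) p).target ∩ (extChartAt 𝓘(ℝ, F) p).symm ⁻¹' U) := by
  have : IsManifold 𝓘(ℂ, F) 1 N := .of_le (n := ω) (by simp)
  have h1 : MDifferentiableOn 𝓘(ℂ, F) 𝓘(ℂ, ℂ) (f ∘ (extChartAt 𝓘(ℂ, F) p).symm)
      ((extChartAt 𝓘(ℂ, F) p).target ∩ (extChartAt 𝓘(ℂ, F) p).symm ⁻¹' U) :=
    hf.comp ((mdifferentiableOn_extChartAt_symm (I := 𝓘(ℂ, F)) (x := p)).mono inter_subset_left)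
      fun y hy => hy.2
  exact mdifferentiableOn_iff_differentiableOn.1 h1

theorem isOpen_target_inter_preimage {U : Set N} (hU : IsOpen U) (p : N) :
    IsOpen ((extChartAt 𝓘(ℝ, F) p).target ∩ (extChartAt 𝓘(ℝ, F) p).symm ⁻¹' U) :=
  (continuousOn_extChartAt_symm p).isOpen_inter_preimage (isOpen_extChartAt_target p) hU

theorem mem_target_inter_preimage {U : Set N} {p : N} (hp : p ∈ U) :
    extChartAt 𝓘(ℝ, F) p p ∈
      (extChartAt 𝓘(ℝ, F) p).target ∩ (extChartAt 𝓘(ℝ, F) p).symm ⁻¹' U :=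
  ⟨mem_extChartAt_target p, by simpa using hp⟩

variable [IsManifold 𝓘(ℂ, F) ω N] [FiniteDimensional ℂ F]

theorem contDiffAt_comp_symm_of_mdifferentiableOn {f : N → ℂ} {U : Set N} (hU : IsOpen U)
    (hf : MDifferentiableOn 𝓘(ℂ, F) 𝓘(ℂ, ℂ) f U) {p : N} (hp : p ∈ U) :
    ContDiffAt ℝ ∞ (f ∘ (extChartAt 𝓘(ℝ, F) p).symm) (extChartAt 𝓘(ℝ, F) p p) :=
  ((contDiffOn_of_differentiableOn_isOpen (isOpen_target_inter_preimage hU p)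
    (differentiableOn_comp_symm hf p)).restrict_scalars ℝ).contDiffAt
      ((isOpen_target_inter_preimage hU p).mem_nhds (mem_target_inter_preimage hp))

/-- Holomorphic functions on complex manifolds are smooth. -/
theorem contMDiffOn_of_mdifferentiableOn {f : N → ℂ} {U : Set N} (hU : IsOpen U)
    (hf : MDifferentiableOn 𝓘(ℂ, F) 𝓘(ℂ, ℂ) f U) :
    ContMDiffOn 𝓘(ℝ, F) 𝓘(ℝ, ℂ) ∞ f U := by
  intro p hp
  refine ContMDiffAt.contMDiffWithinAt (contMDiffAt_iff.2 ⟨?_, ?_⟩)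
  · exact (hf p hp).continuousWithinAt.continuousAt (hU.mem_nhds hp)
  · rw [modelWithCornersSelf_coe, range_id, contDiffWithinAt_univ]
    exact contDiffAt_comp_symm_of_mdifferentiableOn hU hf hp

end Holomorphic

/-! ### Local representatives of maps between manifolds -/

section Maps

variable {E : Type*} [NormedAddCommGroup E] [NormedSpace ℝ E]
  {M : Type*} [TopologicalSpace M] [ChartedSpace E M]
  {F : Type*} [NormedAddCommGroup F] [NormedSpace ℝ F]
  {N : Type*} [TopologicalSpace N] [ChartedSpace F N]

theorem contDiffAt_writtenInExtChartAt {φ : M → N} {x : M} {n : ℕ∞ω}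
    (hφ : ContMDiffAt 𝓘(ℝ, E) 𝓘(ℝ, F) n φ x) :
    ContDiffAt ℝ n (writtenInExtChartAt 𝓘(ℝ, E) 𝓘(ℝ, F) x φ) (extChartAt 𝓘(ℝ, E) x x) := by
  have h2 := (contMDiffAt_iff.1 hφ).2
  rw [modelWithCornersSelf_coe, range_id, contDiffWithinAt_univ] at h2
  exact h2

theorem writtenInExtChartAt_self (φ : M → N) (x : M) :
    writtenInExtChartAt 𝓘(ℝ, E) 𝓘(ℝ, F) x φ (extChartAt 𝓘(ℝ, E) x x) =
      extChartAt 𝓘(ℝ, F) (φ x) (φ x) := by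
  simp [writtenInExtChartAt]

theorem comp_symm_eventuallyEq {V : Type*} {φ : M → N} {x : M} (hφ : ContinuousAt φ x)
    (f : N → V) : (f ∘ φ) ∘ (extChartAt 𝓘(ℝ, E) x).symm =ᶠ[𝓝 (extChartAt 𝓘(ℝ, E) x x)]
      (f ∘ (extChartAt 𝓘(ℝ, F) (φ x)).symm) ∘ writtenInExtChartAt 𝓘(ℝ, E) 𝓘(ℝ, F) x φ := by
  have h1 := (hφ.tendsto.comp (extChartAt_symm_tendsto (E := E) x)).eventually
    (extChartAt_source_mem_nhds (I := 𝓘(ℝ, F)) (φ x))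
  filter_upwards [h1] with y hy
  simp only [Function.comp_apply, writtenInExtChartAt]
  exact congrArg f ((extChartAt 𝓘(ℝ, F) (φ x)).left_inv hy).symm

variable [IsManifold 𝓘(ℝ, E) ∞ M] [FiniteDimensional ℝ E]

/-- Separates the part of the tension field that does not see the target metric from the Christoffel
term, which isotropy will kill. -/
theorem tension_eq [IsManifold 𝓘(ℝ, F) ∞ N] (g : SmoothMetric E M) (h : SmoothMetric F N) (φ : M → N) (x : M) :
    (tension g h φ x : F) =
      localLaplacian (chartMetric g x) (writtenInExtChartAt 𝓘(ℝ, E) 𝓘(ℝ, F) x φ)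
        (extChartAt 𝓘(ℝ, E) x x) +
      metricTrace (chartMetric g x (extChartAt 𝓘(ℝ, E) x x)) fun u v =>
        christoffel (chartMetric h (φ x)) (extChartAt 𝓘(ℝ, F) (φ x) (φ x))
          (fderiv ℝ (writtenInExtChartAt 𝓘(ℝ, E) 𝓘(ℝ, F) x φ) (extChartAt 𝓘(ℝ, E) x x) u)
          (fderiv ℝ (writtenInExtChartAt 𝓘(ℝ, E) 𝓘(ℝ, F) x φ) (extChartAt 𝓘(ℝ, E) x x) v) := by
  unfold localLaplacian
  rw [← metricTrace_add]
  rfl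

/-- The Laplace-Beltrami operator of `f ∘ φ` in terms of the local representatives. -/
theorem laplaceBeltrami_comp_map (g : SmoothMetric E M) {V : Type*} [NormedAddCommGroup V]
    [NormedSpace ℝ V] {φ : M → N} {x : M} (hφ : ContMDiffAt 𝓘(ℝ, E) 𝓘(ℝ, F) 2 φ x) {f : N → V}
    (hf : ContDiffAt ℝ 2 (f ∘ (extChartAt 𝓘(ℝ, F) (φ x)).symm)
      (extChartAt 𝓘(ℝ, F) (φ x) (φ x))) :
    laplaceBeltrami g (f ∘ φ) x =
      fderiv ℝ (f ∘ (extChartAt 𝓘(ℝ, F) (φ x)).symm) (extChartAt 𝓘(ℝ, F) (φ x) (φ x))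
        (localLaplacian (chartMetric g x) (writtenInExtChartAt 𝓘(ℝ, E) 𝓘(ℝ, F) x φ)
          (extChartAt 𝓘(ℝ, E) x x)) +
      metricTrace (chartMetric g x (extChartAt 𝓘(ℝ, E) x x)) fun u v =>
        fderiv ℝ (fderiv ℝ (f ∘ (extChartAt 𝓘(ℝ, F) (φ x)).symm))
          (extChartAt 𝓘(ℝ, F) (φ x) (φ x))
          (fderiv ℝ (writtenInExtChartAt 𝓘(ℝ, E) 𝓘(ℝ, F) x φ) (extChartAt 𝓘(ℝ, E) x x) u)
          (fderiv ℝ (writtenInExtChartAt 𝓘(ℝ, E) 𝓘(ℝ, F) x φ) (extChartAt 𝓘(ℝ, E) x x) v) := by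
  rw [laplaceBeltrami_eq, localLaplacian_congr _ (comp_symm_eventuallyEq (F := F)
    hφ.continuousAt f), localLaplacian_comp _ (by rwa [writtenInExtChartAt_self])
    (contDiffAt_writtenInExtChartAt hφ), writtenInExtChartAt_self]

end Maps

/-! ### Pseudo harmonic morphisms -/

section PseudoHarmonic

variable {E : Type*} [NormedAddCommGroup E] [NormedSpace ℝ E] [FiniteDimensional ℝ E]
  {M : Type*} [TopologicalSpace M] [ChartedSpace E M] [IsManifold 𝓘(ℝ, E) ∞ M]
  {F : Type*} [NormedAddCommGroup F] [NormedSpace ℂ F] [FiniteDimensional ℂ F]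
  {N : Type*} [TopologicalSpace N] [ChartedSpace F N] [IsManifold 𝓘(ℂ, F) ω N]

/-- Pseudo horizontal weak conformality means that the differentials are isotropic. -/
theorem isPHWC_iff (g : SmoothMetric E M) {h : SmoothMetric F N} (hh : IsHermitianMetric h)
    {φ : M → N} (hφ : ContMDiff 𝓘(ℝ, E) 𝓘(ℝ, F) ∞ φ) :
    IsPHWC g h φ ↔ ∀ x, IsIsotropic (chartMetric g x (extChartAt 𝓘(ℝ, E) x x))
      (fderiv ℝ (writtenInExtChartAt 𝓘(ℝ, E) 𝓘(ℝ, F) x φ) (extChartAt 𝓘(ℝ, E) x x)) := by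
  refine forall_congr' fun x => ?_
  have hd : (mfderiv 𝓘(ℝ, E) 𝓘(ℝ, F) φ x : E →L[ℝ] F) =
      fderiv ℝ (writtenInExtChartAt 𝓘(ℝ, E) 𝓘(ℝ, F) x φ) (extChartAt 𝓘(ℝ, E) x x) := by
    have h1 := ((hφ x).mdifferentiableAt (by simp)).mfderiv
    rw [modelWithCornersSelf_coe, range_id, fderivWithin_univ] at h1
    exact h1
  have hpos : ∀ v : F, v ≠ 0 → 0 < (h.inner (φ x) : F →L[ℝ] F →L[ℝ] ℝ) v v := h.pos (φ x)
  have hI : ∀ u v : F, (h.inner (φ x) : F →L[ℝ] F →L[ℝ] ℝ) (Complex.I • u) (Complex.I • v) =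
      (h.inner (φ x) : F →L[ℝ] F →L[ℝ] ℝ) u v := hh (φ x)
  rw [chartMetric_self, ← hd]
  exact ⟨fun hP => isIsotropic_of_commute hpos hI hP, fun hQ => IsIsotropic.commute (E := E) (F := F) hI hQ⟩

/-- Closedness of the fundamental form is used here: the Christoffel symbols are complex linear in
the first slot, hence by symmetry in both, and isotropy applies. -/
theorem IsKahlerMetric.metricTrace_christoffel {h : SmoothMetric F N} (hh : IsKahlerMetric h)
    (p : N) {G : E →L[ℝ] E →L[ℝ] ℝ} {D : E →L[ℝ] F} (hD : IsIsotropic G D) :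
    metricTrace G (fun u v =>
      christoffel (chartMetric h p) (extChartAt 𝓘(ℝ, F) p p) (D u) (D v)) = 0 := by
  have h1 : ∀ u v, christoffel (chartMetric h p) (extChartAt 𝓘(ℝ, F) p p) u v =
      christoffel (chartMetric h p) (extChartAt 𝓘(ℝ, F) p p) v u :=
    christoffel_comm (differentiableAt_chartMetric h p)
      (.of_forall fun y => chartMetric_symm h p y)
  exact hD.metricTrace_eq_zero (christoffelBilin (chartMetric h p) (extChartAt 𝓘(ℝ, F) p p))
    (fun u v => hh.christoffel_I_smul p u v) fun u v => by
      change christoffel _ _ u (Complex.I • v) = Complex.I • christoffel _ _ u v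
      rw [h1, hh.christoffel_I_smul, h1]

theorem IsIsotropic.tension_eq_localLaplacian {g : SmoothMetric E M} {h : SmoothMetric F N}
    (hh : IsKahlerMetric h) {φ : M → N} {x : M}
    (hD : IsIsotropic (chartMetric g x (extChartAt 𝓘(ℝ, E) x x))
      (fderiv ℝ (writtenInExtChartAt 𝓘(ℝ, E) 𝓘(ℝ, F) x φ) (extChartAt 𝓘(ℝ, E) x x))) :
    (tension g h φ x : F) = localLaplacian (chartMetric g x)
      (writtenInExtChartAt 𝓘(ℝ, E) 𝓘(ℝ, F) x φ) (extChartAt 𝓘(ℝ, E) x x) := by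
  rw [tension_eq, hh.metricTrace_christoffel (φ x) hD, add_zero]

variable {g : SmoothMetric E M} {h : SmoothMetric F N} {φ : M → N}

/-- A pseudo harmonic morphism pulls back holomorphic functions to harmonic functions with
isotropic differential. -/
theorem IsPseudoHarmonicMorphism.comp_holomorphic (hφ : IsPseudoHarmonicMorphism g h φ)
    (hh : IsKahlerMetric h) {U : Set N} {f : N → ℂ} (hU : IsOpen U)
    (hf : MDifferentiableOn 𝓘(ℂ, F) 𝓘(ℂ, ℂ) f U) {x : M} (hx : φ x ∈ U) :
    laplaceBeltrami g (f ∘ φ) x = 0 ∧ complexGradSq g (f ∘ φ) x = 0 := by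
  obtain ⟨⟨hs, hτ⟩, hP⟩ := hφ
  have hD := (isPHWC_iff g hh.1 hs).1 hP x
  have hK := contDiffAt_comp_symm_of_mdifferentiableOn hU hf hx
  have hK2 : ContDiffAt ℝ 2 (f ∘ (extChartAt 𝓘(ℝ, F) (φ x)).symm)
    (extChartAt 𝓘(ℝ, F) (φ x) (φ x)) := hK.of_le ENat.LEInfty.out
  have hKd : ∀ᶠ z in 𝓝 (extChartAt 𝓘(ℝ, F) (φ x) (φ x)),
      DifferentiableAt ℂ (f ∘ (extChartAt 𝓘(ℝ, F) (φ x)).symm) z := by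
    have hO := isOpen_target_inter_preimage (F := F) hU (φ x)
    filter_upwards [hO.mem_nhds (mem_target_inter_preimage hx)] with z hz
    exact (differentiableOn_comp_symm hf (φ x)).differentiableAt (hO.mem_nhds hz)
  have hφ2 : ContMDiffAt 𝓘(ℝ, E) 𝓘(ℝ, F) 2 φ x := (hs x).of_le ENat.LEInfty.out
  constructor
  · rw [laplaceBeltrami_comp_map g hφ2 hK2, ← hD.tension_eq_localLaplacian hh, hτ x]
    have hsymm : IsSymmSndFDerivAt ℝ (f ∘ (extChartAt 𝓘(ℝ, F) (φ x)).symm)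
      (extChartAt 𝓘(ℝ, F) (φ x) (φ x)) := hK2.isSymmSndFDerivAt (by simp)
    have hr := fderiv_fderiv_I_smul hKd hK2
    -- The coordinate Hessian of a holomorphic function is complex linear in the second slot by
    -- `hr`, and in the first by symmetry.
    have hB := hD.metricTrace_eq_zero ((ContinuousLinearMap.coeLM ℝ).comp
      (fderiv ℝ (fderiv ℝ (f ∘ (extChartAt 𝓘(ℝ, F) (φ x)).symm))
        (extChartAt 𝓘(ℝ, F) (φ x) (φ x)) : F →ₗ[ℝ] F →L[ℝ] ℂ))
      (fun u v => (hsymm _ _).trans ((hr v u).trans (congrArg _ (hsymm _ _)))) hr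
    refine (congrArg₂ (· + ·) (ContinuousLinearMap.map_zero _) hB).trans (add_zero 0)
  · have hl := hKd.self_of_nhds.hasFDerivAt
    set l := fderiv ℂ (f ∘ (extChartAt 𝓘(ℝ, F) (φ x)).symm) (extChartAt 𝓘(ℝ, F) (φ x) (φ x))
    have hd : fderiv ℝ ((f ∘ φ) ∘ (extChartAt 𝓘(ℝ, E) x).symm) (extChartAt 𝓘(ℝ, E) x x) =
        (l.restrictScalars ℝ).comp (fderiv ℝ (writtenInExtChartAt 𝓘(ℝ, E) 𝓘(ℝ, F) x φ)
          (extChartAt 𝓘(ℝ, E) x x)) := by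
      rw [(comp_symm_eventuallyEq (F := F) hφ2.continuousAt f).fderiv_eq]
      refine HasFDerivAt.fderiv (HasFDerivAt.comp _ ?_
        ((contDiffAt_writtenInExtChartAt hφ2).differentiableAt two_ne_zero).hasFDerivAt)
      rw [writtenInExtChartAt_self]
      exact hl.restrictScalars ℝ
    -- Since `d(f ∘ φ) = l ∘ D`, the gradient square is `l` applied to the isotropy contraction for
    -- `l` itself.
    have h1 := map_metricTrace (l.restrictScalars ℝ)
      (chartMetric g x (extChartAt 𝓘(ℝ, E) x x)) fun u v =>
      l (fderiv ℝ (writtenInExtChartAt 𝓘(ℝ, E) 𝓘(ℝ, F) x φ) (extChartAt 𝓘(ℝ, E) x x) u) •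
        fderiv ℝ (writtenInExtChartAt 𝓘(ℝ, E) 𝓘(ℝ, F) x φ) (extChartAt 𝓘(ℝ, E) x x) v
    rw [hD l, map_zero] at h1
    unfold complexGradSq
    rw [hd, h1]
    congr 1
    ext u v
    simp

theorem IsPseudoHarmonicMorphism.comp_isPMHolomorphicOn (hφ : IsPseudoHarmonicMorphism g h φ)
    (hh : IsKahlerMetric h) {U : Set N} {f : N → ℂ} (hU : IsOpen U)
    (hf : IsPMHolomorphicOn (F := F) f U) :
    ContMDiffOn 𝓘(ℝ, E) 𝓘(ℝ, ℂ) ∞ (f ∘ φ) (φ ⁻¹' U) ∧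
      (∀ x ∈ φ ⁻¹' U, laplaceBeltrami g (f ∘ φ) x = 0) ∧
      ∀ x ∈ φ ⁻¹' U, complexGradSq g (f ∘ φ) x = 0 := by
  have hsm : ∀ {f : N → ℂ}, MDifferentiableOn 𝓘(ℂ, F) 𝓘(ℂ, ℂ) f U →
      ContMDiffOn 𝓘(ℝ, E) 𝓘(ℝ, ℂ) ∞ (f ∘ φ) (φ ⁻¹' U) := fun hf =>
    (contMDiffOn_of_mdifferentiableOn hU hf).comp hφ.1.1.contMDiffOn fun x hx => hx
  rcases hf with hf | hf
  · exact ⟨hsm hf, fun x hx => (hφ.comp_holomorphic hh hU hf hx).1,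
      fun x hx => (hφ.comp_holomorphic hh hU hf hx).2⟩
  -- Antiholomorphic case: the metric is real, so the Laplacian and the gradient square commute with
  -- conjugation.
  · have hc : f ∘ φ = fun x => conj (((fun p => conj (f p)) ∘ φ) x) := by
      ext x; simp
    have hsx : ∀ x ∈ φ ⁻¹' U,
        ContMDiffAt 𝓘(ℝ, E) 𝓘(ℝ, ℂ) 2 ((fun p => conj (f p)) ∘ φ) x := fun x hx =>
      (((hsm hf) x hx).contMDiffAt
        ((hU.preimage hφ.1.1.continuous).mem_nhds hx)).of_le ENat.LEInfty.out
    rw [hc]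
    refine ⟨?_, fun x hx => ?_, fun x hx => ?_⟩
    · exact (Complex.conjCLE : ℂ →L[ℝ] ℂ).contMDiff.comp_contMDiffOn (hsm hf)
    · rw [laplaceBeltrami_conj g (hsx x hx), (hφ.comp_holomorphic hh hU hf hx).1, map_zero]
    · rw [complexGradSq_conj g (hsx x hx), (hφ.comp_holomorphic hh hU hf hx).2, map_zero]

/-- A smooth map that pulls back holomorphic functions to harmonic functions is a pseudo harmonic
morphism. -/
theorem isPseudoHarmonicMorphism_of_forall (hh : IsKahlerMetric h)
    (hφ : ContMDiff 𝓘(ℝ, E) 𝓘(ℝ, F) ∞ φ)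
    (H : ∀ (U : Set N) (f : N → ℂ), IsOpen U → MDifferentiableOn 𝓘(ℂ, F) 𝓘(ℂ, ℂ) f U →
      HarmonicOn g (f ∘ φ) (φ ⁻¹' U)) : IsPseudoHarmonicMorphism g h φ := by
  have : IsManifold 𝓘(ℂ, F) 1 N := .of_le (n := ω) (by simp)
  -- The test functions are `q` composed with the holomorphic chart at `φ x`, for `q` entire on the
  -- model space.
  have key : ∀ (x : M) (q : F → ℂ), Differentiable ℂ q → ContDiff ℝ 2 q →
      fderiv ℝ q (extChartAt 𝓘(ℝ, F) (φ x) (φ x))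
        (localLaplacian (chartMetric g x) (writtenInExtChartAt 𝓘(ℝ, E) 𝓘(ℝ, F) x φ)
          (extChartAt 𝓘(ℝ, E) x x)) +
      metricTrace (chartMetric g x (extChartAt 𝓘(ℝ, E) x x)) (fun u v =>
        fderiv ℝ (fderiv ℝ q) (extChartAt 𝓘(ℝ, F) (φ x) (φ x))
          (fderiv ℝ (writtenInExtChartAt 𝓘(ℝ, E) 𝓘(ℝ, F) x φ) (extChartAt 𝓘(ℝ, E) x x) u)
          (fderiv ℝ (writtenInExtChartAt 𝓘(ℝ, E) 𝓘(ℝ, F) x φ)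
            (extChartAt 𝓘(ℝ, E) x x) v)) = 0 := by
    intro x q hq hq2
    have h1 := (H (chartAt F (φ x)).source (q ∘ extChartAt 𝓘(ℂ, F) (φ x))
      (chartAt F (φ x)).open_source
      (hq.mdifferentiable.comp_mdifferentiableOn
        (mdifferentiableOn_extChartAt (I := 𝓘(ℂ, F))))).2 x (mem_chart_source F (φ x))
    have he : (q ∘ extChartAt 𝓘(ℂ, F) (φ x)) ∘ (extChartAt 𝓘(ℝ, F) (φ x)).symm
        =ᶠ[𝓝 (extChartAt 𝓘(ℝ, F) (φ x) (φ x))] q := by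
      filter_upwards [extChartAt_target_mem_nhds_self (φ x)] with z hz
      exact congrArg q ((extChartAt 𝓘(ℝ, F) (φ x)).right_inv hz)
    rw [laplaceBeltrami_comp_map g ((hφ x).of_le ENat.LEInfty.out)
      (hq2.contDiffAt.congr_of_eventuallyEq he), he.fderiv_eq, he.fderiv.fderiv_eq] at h1
    exact h1
  -- For complex linear `q` the Hessian term is absent, and such `q` separate points.
  have hlin : ∀ x, localLaplacian (chartMetric g x) (writtenInExtChartAt 𝓘(ℝ, E) 𝓘(ℝ, F) x φ)
      (extChartAt 𝓘(ℝ, E) x x) = 0 := by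
    intro x
    refine SeparatingDual.eq_zero_of_forall_dual_eq_zero (R := ℂ) fun l => ?_
    have hf1 : fderiv ℝ l = fun _ => l.restrictScalars ℝ := by
      ext1 z; exact (l.restrictScalars ℝ).fderiv
    have h1 := key x l l.differentiable (l.restrictScalars ℝ).contDiff
    rw [hf1] at h1
    simpa [metricTrace] using h1
  have hiso : ∀ x, IsIsotropic (chartMetric g x (extChartAt 𝓘(ℝ, E) x x))
      (fderiv ℝ (writtenInExtChartAt 𝓘(ℝ, E) 𝓘(ℝ, F) x φ) (extChartAt 𝓘(ℝ, E) x x)) := by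
    intro x
    -- For `q = l²` the Hessian is `2 l ⊗ l`, and the first-order term vanishes by `hlin`.
    refine isIsotropic_of_sq (chartMetric_symm g x _) (chartMetric_pos g x) fun l => ?_
    have hf1 : fderiv ℝ (fun z => l z * l z) = fun z => (2 * l z) • l.restrictScalars ℝ := by
      ext1 z
      have h0 : HasFDerivAt l (l.restrictScalars ℝ) z := (l.restrictScalars ℝ).hasFDerivAt
      refine (h0.mul h0).fderiv.trans ?_
      ext v
      simp
      ring
    have hf2 : ∀ z u v, fderiv ℝ (fderiv ℝ fun z => l z * l z) z u v = 2 * (l u * l v) := by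
      intro z u v
      rw [hf1]
      have h0 : HasFDerivAt l (l.restrictScalars ℝ) z := (l.restrictScalars ℝ).hasFDerivAt
      rw [((h0.const_mul 2).smul_const (l.restrictScalars ℝ)).fderiv]
      simp [mul_assoc]
    have h1 := key x (fun z => l z * l z) (l.differentiable.mul l.differentiable)
      ((l.restrictScalars ℝ).contDiff.mul (l.restrictScalars ℝ).contDiff)
    rw [hlin x, map_zero, zero_add] at h1
    simp only [hf2] at h1
    simpa [metricTrace, ← Finset.mul_sum] using h1
  refine ⟨⟨hφ, fun x => ?_⟩, (isPHWC_iff g hh.1 hφ).2 hiso⟩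
  exact ((hiso x).tension_eq_localLaplacian hh).trans (hlin x)

end PseudoHarmonic

end PHM

end

theorem mainTheorem2
    {E : Type*} [NormedAddCommGroup E] [NormedSpace ℝ E] [FiniteDimensional ℝ E]
    {M : Type*} [TopologicalSpace M] [ChartedSpace E M] [IsManifold 𝓘(ℝ, E) ∞ M]
    {F : Type*} [NormedAddCommGroup F] [NormedSpace ℂ F] [FiniteDimensional ℂ F]
    {N : Type*} [TopologicalSpace N] [ChartedSpace F N] [IsManifold 𝓘(ℂ, F) ω N]
    (g : PHM.SmoothMetric E M) (h : PHM.SmoothMetric F N) (hh : PHM.IsKahlerMetric h)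
    (φ : M → N) (hφ : ContMDiff 𝓘(ℝ, E) 𝓘(ℝ, F) ∞ φ) :
    ((∀ (U : Set N) (f : N → ℂ), IsOpen U → PHM.IsPMHolomorphicOn (F := F) f U →
        PHM.HarmonicOn g (f ∘ φ) (φ ⁻¹' U)) ↔
      PHM.IsPseudoHarmonicMorphism g h φ) ∧
    (PHM.IsPseudoHarmonicMorphism g h φ →
      ∀ (U : Set N) (f : N → ℂ), IsOpen U → PHM.IsPMHolomorphicOn (F := F) f U →
        PHM.IsHarmonicMorphismOn g PHM.flatMetric (f ∘ φ) (φ ⁻¹' U)) := by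
  refine ⟨⟨fun H => PHM.isPseudoHarmonicMorphism_of_forall hh hφ fun U f hU hf =>
    H U f hU (Or.inl hf), fun hP U f hU hf => ?_⟩, fun hP U f hU hf => ?_⟩
  · obtain ⟨h1, h2, -⟩ := hP.comp_isPMHolomorphicOn hh hU hf
    exact ⟨h1.of_le ENat.LEInfty.out, h2⟩
  · obtain ⟨h1, h2, h3⟩ := hP.comp_isPMHolomorphicOn hh hU hf
    exact PHM.isHarmonicMorphismOn_of_complexGradSq (hU.preimage hφ.continuous) h1 h2 h3
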